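/- Let $k$ be a perfect field of characteristic $p>0$ and let $H$ be a commutative Hopf algebra over $k$ that is finitely generated as a $k$-algebra. Then the nilradical $\operatorname{Nil}H$ is a Hopf ideal; let $H_{\operatorname{red}}:=H/\operatorname{Nil}H$ be the quotient Hopf algebra and $\pi:H\to H_{\operatorname{red}}$ the projection. Regard $H$ as a right $H_{\operatorname{red}}$-comodule algebra by the coaction $h\mapsto h_{(1)}\otimes\pi(h_{(2)})$. If $\operatorname{Nil}H\neq 0$, then there are positive integers $n$ and $e_1,\dots,e_n$ and an isomorphism of right $H_{\operatorname{red}}$-comodule algebras (that is, an $H_{\operatorname{red}}$-colinear isomorphism of $k$-algebras) \[ H\;\cong\;k[T_1,\dots,T_n]/(T_1^{p^{e_1}},\dots,T_n^{p^{e_n}})\otimes_k H_{\operatorname{red}}, \] where the coaction on the right-hand side is $b\otimes a\mapsto b\otimes a_{(1)}\otimes a_{(2)}$. -/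

import Mathlib

open scoped TensorProduct

namespace HopfRed

universe u v w w'

section ComoduleAlgebra

variable {k : Type u} {K : Type v} [Field k] [CommRing K] [Bialgebra k K]

/-- A right `K`-comodule algebra structure on the commutative `k`-algebra `A`: a coaction
`A → A ⊗ K` which is an algebra map and is coassociative and counital. -/
structure ComoduleAlgebra (k : Type u) (K : Type v) (A : Type w) [Field k] [CommRing K]
    [Bialgebra k K] [CommRing A] [Algebra k A] where
  /-- The coaction. -/
  coact : A →ₐ[k] A ⊗[k] K
  coassoc : (Algebra.TensorProduct.assoc k k k A K K).toAlgHom.comp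
      ((Algebra.TensorProduct.map coact (AlgHom.id k K)).comp coact) =
    (Algebra.TensorProduct.map (AlgHom.id k A) (Bialgebra.comulAlgHom k K)).comp coact
  counital : (Algebra.TensorProduct.map (AlgHom.id k A) (Bialgebra.counitAlgHom k K)).comp coact =
    (Algebra.TensorProduct.rid k k A).symm.toAlgHom

/-- An isomorphism of right `K`-comodule algebras: a `K`-colinear algebra isomorphism. -/
structure ComoduleAlgebra.Iso {A : Type w} {B : Type w'} [CommRing A] [Algebra k A] [CommRing B]
    [Algebra k B] (ρ : ComoduleAlgebra k K A) (σ : ComoduleAlgebra k K B) extends A ≃ₐ[k] B where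
  colinear : ∀ a : A, σ.coact (toAlgEquiv a) =
    Algebra.TensorProduct.map toAlgEquiv.toAlgHom (AlgHom.id k K) (ρ.coact a)

/-- Given a bialgebra map `f : H → K`, the algebra `H` is a right `K`-comodule algebra with
coaction `h ↦ h₍₁₎ ⊗ f (h₍₂₎)`. -/
noncomputable def ComoduleAlgebra.ofBialgHom {H : Type w} [CommRing H] [Bialgebra k H]
    (f : H →ₐc[k] K) : ComoduleAlgebra k K H where
  coact := (Algebra.TensorProduct.map (AlgHom.id k H) (f : H →ₐ[k] K)).comp
    (Bialgebra.comulAlgHom k H)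
  coassoc := by
    have hf : (Bialgebra.comulAlgHom k K).comp (f : H →ₐ[k] K) =
        (Algebra.TensorProduct.map (f : H →ₐ[k] K) (f : H →ₐ[k] K)).comp
          (Bialgebra.comulAlgHom k H) :=
      AlgHom.ext fun a => (CoalgHomClass.map_comp_comul_apply f a).symm
    have h1 : ∀ t : H ⊗[k] H, Algebra.TensorProduct.assoc k k k H K K
        (Algebra.TensorProduct.map ((Algebra.TensorProduct.map (AlgHom.id k H)
          (f : H →ₐ[k] K)).comp (Bialgebra.comulAlgHom k H)) (AlgHom.id k K)
            (Algebra.TensorProduct.map (AlgHom.id k H) (f : H →ₐ[k] K) t)) =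
        Algebra.TensorProduct.map (AlgHom.id k H) (Algebra.TensorProduct.map (f : H →ₐ[k] K)
          (f : H →ₐ[k] K)) (TensorProduct.assoc k H H H
            (TensorProduct.map Coalgebra.comul LinearMap.id t)) := by
      intro t
      induction t with
      | zero => simp
      | add x y hx hy => simp only [map_add, hx, hy]
      | tmul x y =>
        simp only [Algebra.TensorProduct.map_tmul, AlgHom.comp_apply, AlgHom.id_apply,
          TensorProduct.map_tmul, LinearMap.id_apply, Bialgebra.comulAlgHom_apply]
        generalize (Coalgebra.comul (R := k) x) = s
        induction s with
        | zero => simp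
        | add x y hx hy => simp only [map_add, TensorProduct.add_tmul, hx, hy]
        | tmul u v => simp
    refine AlgHom.ext fun a => ?_
    refine (h1 (Coalgebra.comul a)).trans ?_
    have h3 : TensorProduct.assoc k H H H
        (TensorProduct.map Coalgebra.comul LinearMap.id (Coalgebra.comul (R := k) a)) =
        Algebra.TensorProduct.map (AlgHom.id k H) (Bialgebra.comulAlgHom k H)
          (Coalgebra.comul (R := k) a) :=
      Coalgebra.coassoc_apply a
    rw [h3]
    simp only [← AlgHom.comp_apply, ← Algebra.TensorProduct.map_comp, ← hf]
    simp only [AlgHom.comp_apply, Bialgebra.comulAlgHom_apply, ← AlgHom.comp_assoc,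
      ← Algebra.TensorProduct.map_comp]
  counital := by
    have hf : (Bialgebra.counitAlgHom k K).comp (f : H →ₐ[k] K) = Bialgebra.counitAlgHom k H :=
      AlgHom.ext fun a => CoalgHomClass.counit_comp_apply f a
    rw [← AlgHom.comp_assoc, ← Algebra.TensorProduct.map_comp, hf]
    exact AlgHom.ext fun a => Coalgebra.lTensor_counit_comul a

/-- For a `k`-algebra `B`, the algebra `B ⊗ K` is a right `K`-comodule algebra with coaction
`b ⊗ x ↦ b ⊗ x₍₁₎ ⊗ x₍₂₎`, that is, `B` is regarded as a trivial comodule. -/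
noncomputable def ComoduleAlgebra.tensor (B : Type w) [CommRing B] [Algebra k B] :
    ComoduleAlgebra k K (B ⊗[k] K) where
  coact := (Algebra.TensorProduct.assoc k k k B K K).symm.toAlgHom.comp
    (Algebra.TensorProduct.map (AlgHom.id k B) (Bialgebra.comulAlgHom k K))
  coassoc := by
    have h1 : ∀ (b : B) (t : K ⊗[k] K), Algebra.TensorProduct.assoc k k k (B ⊗[k] K) K K
        (Algebra.TensorProduct.map ((Algebra.TensorProduct.assoc k k k B K K).symm.toAlgHom.comp
          (Algebra.TensorProduct.map (AlgHom.id k B) (Bialgebra.comulAlgHom k K)))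
          (AlgHom.id k K) ((Algebra.TensorProduct.assoc k k k B K K).symm (b ⊗ₜ t))) =
        (TensorProduct.assoc k B K (K ⊗[k] K)).symm (b ⊗ₜ (TensorProduct.assoc k K K K
          (TensorProduct.map Coalgebra.comul LinearMap.id t))) := by
      intro b t
      induction t with
      | zero => simp
      | add x y hx hy => simp only [map_add, TensorProduct.tmul_add, hx, hy]
      | tmul x y =>
        simp only [Algebra.TensorProduct.map_tmul, AlgHom.comp_apply, AlgHom.id_apply,
          Algebra.TensorProduct.assoc_symm_tmul,
          TensorProduct.map_tmul, LinearMap.id_apply, Bialgebra.comulAlgHom_apply]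
        generalize (Coalgebra.comul (R := k) x) = s
        induction s with
        | zero => simp
        | add x y hx hy => simp only [map_add, TensorProduct.add_tmul, TensorProduct.tmul_add, hx, hy]
        | tmul u v => simp
    have h2 : ∀ (b : B) (t : K ⊗[k] K),
        (Algebra.TensorProduct.map (AlgHom.id k (B ⊗[k] K)) (Bialgebra.comulAlgHom k K))
          ((Algebra.TensorProduct.assoc k k k B K K).symm (b ⊗ₜ t)) =
        (TensorProduct.assoc k B K (K ⊗[k] K)).symm
          (b ⊗ₜ (TensorProduct.map LinearMap.id Coalgebra.comul t)) := by
      intro b t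
      induction t with
      | zero => simp
      | add x y hx hy => simp only [map_add, TensorProduct.tmul_add, hx, hy]
      | tmul x y => simp
    refine AlgHom.ext fun z => ?_
    induction z with
    | zero => simp
    | add x y hx hy => simp only [map_add, hx, hy]
    | tmul b x =>
      refine (h1 b (Coalgebra.comul x)).trans (Eq.trans ?_ (h2 b (Coalgebra.comul x)).symm)
      exact congrArg (fun y => (TensorProduct.assoc k B K (K ⊗[k] K)).symm (b ⊗ₜ y))
        (Coalgebra.coassoc_apply x)
  counital := by
    have h1 : ∀ (b : B) (t : K ⊗[k] K),
        (Algebra.TensorProduct.map (AlgHom.id k (B ⊗[k] K)) (Bialgebra.counitAlgHom k K))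
          ((Algebra.TensorProduct.assoc k k k B K K).symm (b ⊗ₜ t)) =
        (TensorProduct.assoc k B K k).symm
          (b ⊗ₜ (LinearMap.lTensor K Coalgebra.counit t)) := by
      intro b t
      induction t with
      | zero => simp
      | add x y hx hy => simp only [map_add, TensorProduct.tmul_add, hx, hy]
      | tmul x y => simp
    refine AlgHom.ext fun z => ?_
    induction z with
    | zero => simp
    | add x y hx hy => simp only [map_add, hx, hy]
    | tmul b x =>
      refine (h1 b (Coalgebra.comul x)).trans ?_
      rw [Coalgebra.lTensor_counit_comul]
      rfl

end ComoduleAlgebra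

/-- Over a perfect field of characteristic `p`, the tensor product of two reduced algebras is
reduced. -/
theorem isReduced_tensorProduct {k : Type u} [Field k] (p : ℕ) [Fact p.Prime] [CharP k p] [PerfectField k]
    {A : Type v} {B : Type w} [CommRing A] [CommRing B] [Algebra k A] [Algebra k B]
    [IsReduced A] [IsReduced B] : IsReduced (A ⊗[k] B) := by
  classical
  rcases subsingleton_or_nontrivial (A ⊗[k] B) with hs | hn
  · infer_instance
  have : Nontrivial A := by
    by_contra h
    rw [not_nontrivial_iff_subsingleton] at h
    exact not_subsingleton (A ⊗[k] B) inferInstance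
  have : CharP A p := charP_of_injective_algebraMap (algebraMap k A).injective p
  have : CharP (A ⊗[k] B) p :=
    charP_of_injective_algebraMap (algebraMap k (A ⊗[k] B)).injective p
  have : PerfectRing k p := PerfectField.toPerfectRing p
  let e := Module.Basis.ofVectorSpace k A
  have hli : LinearIndependent k (fun i => e i ^ p) := by
    rw [linearIndependent_iff']
    intro s g hg i hi
    choose c hc using fun i => surjective_frobenius k p (g i)
    have h1 : (∑ i ∈ s, c i • e i) ^ p = 0 := by
      rw [sum_pow_char, ← hg]
      refine Finset.sum_congr rfl fun j _ => ?_
      rw [smul_pow, ← frobenius_def, hc]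
    have h2 := (linearIndependent_iff'.1 e.linearIndependent) s c (pow_eq_zero_iff
      (Fact.out : p.Prime).ne_zero |>.1 h1) i hi
    rw [← hc, h2, map_zero]
  have key : ∀ x : A ⊗[k] B, x ^ p = 0 → x = 0 := by
    intro x hx
    obtain ⟨c, rfl⟩ := TensorProduct.eq_repr_basis_left e x
    have hx' : ∑ i ∈ c.support, (e i ^ p) ⊗ₜ[k] (c i ^ p) = 0 := by
      rw [← hx, Finsupp.sum, sum_pow_char]
      simp [Algebra.TensorProduct.tmul_pow]
    obtain ⟨g, hg⟩ := LinearMap.exists_leftInverse_of_injective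
      (Finsupp.linearCombination k (fun i => e i ^ p)) (LinearMap.ker_eq_bot.2 hli)
    have hgi : ∀ i, g (e i ^ p) = Finsupp.single i 1 := fun i => by
      simpa using LinearMap.congr_fun hg (Finsupp.single i 1)
    refine Finset.sum_eq_zero fun i hi => ?_
    have h3 := congrArg (fun y => TensorProduct.lid k B
      (LinearMap.rTensor B (Finsupp.lapply i ∘ₗ g) y)) hx'
    simp only [map_sum, LinearMap.rTensor_tmul, LinearMap.comp_apply, hgi, Finsupp.lapply_apply,
      TensorProduct.lid_tmul, map_zero, Finsupp.single_apply, ite_smul, one_smul, zero_smul] at h3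
    rw [Finset.sum_ite_eq' c.support i, if_pos hi] at h3
    exact (congrArg (fun y => e i ⊗ₜ[k] y) (eq_zero_of_pow_eq_zero h3)).trans
      (TensorProduct.tmul_zero _ _)
  have key' : ∀ (n : ℕ) (x : A ⊗[k] B), x ^ p ^ n = 0 → x = 0 := by
    intro n
    induction n with
    | zero => intro x hx; simpa using hx
    | succ n ih => intro x hx; exact ih x (key _ (by rw [← pow_mul, ← pow_succ]; exact hx))
  refine ⟨fun x ⟨n, hn⟩ => key' n x ?_⟩
  exact pow_eq_zero_of_le (Nat.lt_pow_self (Fact.out : p.Prime).one_lt).le hn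

/-- Over a perfect field of characteristic `p`, the nilradical of a commutative Hopf algebra is a
Hopf ideal. -/
theorem nilradical_isHopfIdeal {k : Type u} [Field k] (p : ℕ) [Fact p.Prime] [CharP k p] [PerfectField k]
    (H : Type v) [CommRing H] [HopfAlgebra k H] :
    (nilradical H).IsHopfIdeal k where
  counit_eq_zero x hx :=
    (((mem_nilradical.1 hx).map (Bialgebra.counitAlgHom k H)).eq_zero :)
  map_mkQ_comul_eq_zero x hx := by
    have : IsReduced (H ⧸ nilradical H) :=
      (Ideal.isRadical_iff_quotient_reduced _).1 (Ideal.radical_isRadical _)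
    have : IsReduced ((H ⧸ nilradical H) ⊗[k] (H ⧸ nilradical H)) :=
      isReduced_tensorProduct p
    exact ((mem_nilradical.1 hx).map ((Algebra.TensorProduct.map
      (Ideal.Quotient.mkₐ k (nilradical H)) (Ideal.Quotient.mkₐ k (nilradical H))).comp
      (Bialgebra.comulAlgHom k H))).eq_zero
  antipode_mem x hx :=
    mem_nilradical.2 ((mem_nilradical.1 hx).map (HopfAlgebra.antipodeAlgHom k H))

/-- The truncated polynomial algebra `k[T₁, …, Tₙ] / (T₁ ^ (p ^ e₁), …, Tₙ ^ (p ^ eₙ))`. -/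
abbrev TruncPoly (k : Type u) [Field k] (p : ℕ) {n : ℕ} (e : Fin n → ℕ) : Type u :=
  MvPolynomial (Fin n) k ⧸
    Ideal.span (Set.range fun i : Fin n => (MvPolynomial.X i : MvPolynomial (Fin n) k) ^ p ^ e i)

end HopfRed

/-! Let `m` be the augmentation ideal, `ε` the counit, `I = Nil H`, `K = H / I`, and `J_M` the ideal
generated by the `p ^ M`-th powers of elements of `m`. Every algebra map `f : H → B` gives a
`K`-colinear algebra map `h ↦ f (h₍₁₎) ⊗ π (h₍₂₎)` (`comparison`). It suffices to find `f` onto a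
truncated polynomial algebra for which this map is bijective.

The map `f` comes from the structure of `H` near the counit. The kernels of the iterated Frobenius
maps induce a flag on `m / m²`. A basis adapted to it lifts to nilpotents `t j` with `t j ^ p ^ e j
= 0` and to parameters `u i` that stay independent modulo `I` (`exists_parameters`). For large `M`,
the monomials with exponents below `p ^ M` in `u` and below `p ^ e j` in `t` form a basis of `H /
J_M`, so killing `J_M` and the `u i` defines `f` (`exists_truncation_hom`).

Linear independence of these monomials is the core. Invariant derivations dual to the generators
kill `p`-th powers, hence separate exponents below `p`. Higher exponents are reached through `H /
ker Frobenius`, which is again a bialgebra because `k` is perfect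
(`exists_mul_pow_eq_zero_of_isAdapted`).

Surjectivity of the comparison holds modulo `I`, and `I` is nilpotent. For injectivity, a dimension
count places the kernel `L` in `J_M` for all large `M`, hence in every power of `m`. Krull's
intersection theorem then gives `c` with `ε c = 1` and `c L = 0`. Thus `L` vanishes near the counit,
and translating by the coaction of `K` makes it vanish everywhere (`comparison_injective`). -/

namespace HopfRed

universe u v w w'

/-! ### Separating exponents below `p` by derivations. -/

section PowerCoefficients

open MvPolynomial

variable {H : Type v} [CommRing H] {p : ℕ} [Fact p.Prime] [CharP H p]
  {R : Type w} [CommRing R] [Algebra R H]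

/-- This is the chain rule without a term for the coefficients: they enter as `p`-th powers, which
every derivation kills. -/
theorem derivation_eval₂_frobenius {ι : Type*} [Fintype ι] (D : Derivation R H H) (x : ι → H)
    (P : MvPolynomial ι H) :
    D (P.eval₂ (frobenius H p) x) =
      ∑ j, D (x j) * (pderiv j P).eval₂ (frobenius H p) x := by
  classical
  induction P using MvPolynomial.induction_on with
  | C a => simp [frobenius_def]
  | add P Q hP hQ => simp [hP, hQ, mul_add, Finset.sum_add_distrib]
  | mul_X P i hP =>
    have h : ∀ j, D (x j) * (pderiv j (P * X i)).eval₂ (frobenius H p) x =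
        x i * (D (x j) * (pderiv j P).eval₂ (frobenius H p) x) +
          if j = i then P.eval₂ (frobenius H p) x * D (x i) else 0 := by
      intro j
      rw [pderiv_mul, pderiv_X, eval₂_add, eval₂_mul, eval₂_mul, eval₂_X]
      by_cases hji : j = i
      · subst hji
        simp
        ring
      · rw [Pi.single_eq_of_ne' hji, if_neg hji]
        simp
        ring
    simp_rw [h]
    rw [Finset.sum_add_distrib, ← Finset.mul_sum, ← hP, Finset.sum_ite_eq' Finset.univ i]
    simp [add_comm]

theorem eval₂_C_mul_frobenius {ι : Type*} (a : H) (x : ι → H) (P : MvPolynomial ι H) :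
    (C a * P).eval₂ (frobenius H p) x = a ^ p * P.eval₂ (frobenius H p) x := by
  rw [eval₂_mul, eval₂_C, frobenius_def]

/-- If derivations `D i` are dual to the elements `x i`, `i ∈ T`, at the point `ε`, then monomials
in these elements with exponents less than `p` are linearly independent over `p`-th powers,
up to multiplication by a function which does not vanish at `ε`. -/
theorem exists_mul_coeff_pow_eq_zero {k : Type u} [Field k] {ι : Type*} [Fintype ι] [DecidableEq ι]
    (ε : H →+* k)
    (x : ι → H) (T : ι → Prop) (D : ι → Derivation R H H)
    (hD : ∀ i j, T i → T j → ε (D i (x j)) = if i = j then 1 else 0) (n : ℕ)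
    (P : MvPolynomial ι H)
    (hP : ∀ b, P.coeff b ≠ 0 → b.degree ≤ n ∧ ∀ i, b i < p ∧ (¬ T i → b i = 0))
    (h0 : P.eval₂ (frobenius H p) x = 0) :
    ∃ s, ε s = 1 ∧ ∀ b, (s * P.coeff b) ^ p = 0 := by
  classical
  have hp : p ≠ 0 := (Fact.out : p.Prime).ne_zero
  induction n generalizing P with
  | zero =>
    refine ⟨1, map_one ε, fun b => ?_⟩
    by_cases hb : P.coeff b = 0
    · simp [hb, hp]
    · have hb0 : ∀ b, P.coeff b ≠ 0 → b = 0 := fun b hb =>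
        (Finsupp.degree_eq_zero_iff b).1 (Nat.le_zero.1 (hP b hb).1)
      have hPC : P = C (P.coeff 0) := by
        ext b
        rw [coeff_C]
        split_ifs with h
        · rw [h]
        · by_contra hne
          exact h (hb0 b hne).symm
      rw [hPC, eval₂_C, frobenius_def] at h0
      rw [hb0 b hb, one_mul, h0]
  | succ n ih =>
    -- Outside `T` the matrix is padded by the identity, so it specialises to the identity at `ε`
    -- and its determinant has value 1 there.
    set A : Matrix ι ι H := Matrix.of fun i j =>
      if T i ∧ T j then D i (x j) else if i = j then 1 else 0 with hA
    have hεA : ε A.det = 1 := by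
      rw [RingHom.map_det]
      have : ε.mapMatrix A = 1 := by
        ext i j
        rw [RingHom.mapMatrix_apply, Matrix.map_apply, hA, Matrix.of_apply, Matrix.one_apply]
        by_cases h : T i ∧ T j
        · rw [if_pos h, hD i j h.1 h.2]
        · rw [if_neg h]
          split_ifs <;> simp
      rw [this, Matrix.det_one]
    set w : ι → H := fun j => (pderiv j P).eval₂ (frobenius H p) x with hw
    have hw0 : ∀ j, ¬ T j → w j = 0 := by
      intro j hj
      have : pderiv j P = 0 := by
        ext b
        rw [coeff_pderiv, coeff_zero]
        by_contra hne
        have h1 := ((hP _ (left_ne_zero_of_mul hne)).2 j).2 hj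
        simp at h1
      rw [hw]
      simp [this]
    -- Applying `D i` to the relation gives a linear system for the partial derivatives of `P`; the
    -- adjugate then yields `det A * w j = 0`.
    have hAw : A.mulVec w = 0 := by
      ext i
      rw [Matrix.mulVec, dotProduct, Pi.zero_apply]
      by_cases hi : T i
      · rw [← map_zero (D i), ← h0, derivation_eval₂_frobenius]
        refine Finset.sum_congr rfl fun j _ => ?_
        by_cases hj : T j
        · simp [hA, hi, hj, hw]
        · have := hw0 j hj
          rw [this, mul_zero]
          simp only [hw] at this
          rw [this, mul_zero]
      · refine Finset.sum_eq_zero fun j _ => ?_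
        by_cases hij : i = j
        · rw [← hij, hw0 i hi, mul_zero]
        · simp [hA, hi, hij]
    have hdet : ∀ j, A.det * w j = 0 := by
      have h1 : A.adjugate.mulVec (A.mulVec w) = A.det • w := by
        rw [Matrix.mulVec_mulVec, Matrix.adjugate_mul, Matrix.smul_mulVec, Matrix.one_mulVec]
      intro j
      have := congrFun h1 j
      rw [hAw, Matrix.mulVec_zero] at this
      simpa using this.symm
    have key : ∀ j, ∃ s, ε s = 1 ∧ ∀ b, (s * (C A.det * pderiv j P).coeff b) ^ p = 0 := by
      intro j
      refine ih _ (fun b hb => ?_) ?_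
      · rw [coeff_C_mul, coeff_pderiv] at hb
        have hb' := hP _ (left_ne_zero_of_mul (right_ne_zero_of_mul hb))
        refine ⟨?_, fun i => ⟨?_, fun hi => ?_⟩⟩
        · have := hb'.1
          rw [map_add, Finsupp.degree_single] at this
          omega
        · have := (hb'.2 i).1
          rw [Finsupp.add_apply] at this
          omega
        · have := (hb'.2 i).2 hi
          rw [Finsupp.add_apply] at this
          omega
      · rw [eval₂_C_mul_frobenius]
        have := hdet j
        obtain ⟨q, rfl⟩ := Nat.exists_eq_succ_of_ne_zero hp
        rw [pow_succ, mul_assoc, this, mul_zero]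
    choose s hs1 hs2 using key
    set S := A.det * ∏ j, s j with hS
    have hS1 : ε S = 1 := by simp [hS, hεA, hs1]
    have hSb : ∀ b, b ≠ 0 → (S * P.coeff b) ^ p = 0 := by
      intro b hb
      by_cases hPb : P.coeff b = 0
      · simp [hPb, hp]
      obtain ⟨j, hj⟩ : ∃ j, b j ≠ 0 := by
        by_contra! h
        exact hb (Finsupp.ext h)
      have h1 := hs2 j (b - Finsupp.single j 1)
      have h2 : b - Finsupp.single j 1 + Finsupp.single j 1 = b := by
        refine tsub_add_cancel_of_le ?_
        rw [Finsupp.single_le_iff]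
        omega
      rw [coeff_C_mul, coeff_pderiv, h2] at h1
      have h3 : (((b - Finsupp.single j 1 : ι →₀ ℕ) j : ℕ) : H) + 1 = (b j : H) := by
        rw [Finsupp.tsub_apply, Finsupp.single_eq_same]
        exact_mod_cast congrArg (Nat.cast (R := H)) (Nat.sub_add_cancel (Nat.pos_of_ne_zero hj))
      rw [h3] at h1
      -- The factor produced by differentiation is invertible since `0 < b j < p`.
      have hu : IsUnit ((b j : ℕ) : H) := by
        rw [CharP.isUnit_natCast_iff (Fact.out : p.Prime)]
        exact Nat.not_dvd_of_pos_of_lt (Nat.pos_of_ne_zero hj) ((hP b hPb).2 j).1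
      rw [← (hu.pow p).mul_left_eq_zero, ← mul_pow, hS, ← Finset.mul_prod_erase _ _ (Finset.mem_univ j)]
      rw [show A.det * (s j * ∏ j ∈ Finset.univ.erase j, s j) * coeff b P * (b j : H) =
        (∏ j ∈ Finset.univ.erase j, s j) * (s j * (A.det * (coeff b P * (b j : H)))) by ring,
        mul_pow, h1, mul_zero]
    refine ⟨S, hS1, fun b => ?_⟩
    by_cases hb : b = 0
    -- Multiplication by `S ^ p` removes all other terms of the relation, leaving only the constant
    -- one.
    · subst hb
      have h1 := congrArg (fun y => S ^ p * y) h0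
      simp only [eval₂_eq, mul_zero, Finset.mul_sum, frobenius_def] at h1
      rw [Finset.sum_eq_single 0] at h1
      · simpa [mul_pow] using h1
      · intro b _ hb
        rw [← mul_assoc, ← mul_pow, hSb b hb, zero_mul]
      · intro h
        rw [notMem_support_iff.1 h]
        simp [hp]
    · exact hSb b hb

end PowerCoefficients

/-! ### Invariant derivations of a bialgebra. -/

section Bialgebra

variable (k : Type u) (H : Type v) [Field k] [CommRing H] [Bialgebra k H]

/-- The augmentation ideal of a bialgebra. -/
noncomputable abbrev augIdeal : Ideal H := RingHom.ker (Bialgebra.counitAlgHom k H)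

variable {k H}

theorem mem_augIdeal {x : H} : x ∈ augIdeal k H ↔ Coalgebra.counit (R := k) x = 0 := Iff.rfl

/-- The invariant derivation `h ↦ h₍₁₎ d(h₍₂₎)` attached to a point derivation `d`. -/
noncomputable def invariantDerivation (d : H →ₗ[k] k)
    (hd : ∀ a b, d (a * b) = Coalgebra.counit (R := k) a * d b + Coalgebra.counit (R := k) b * d a) :
    Derivation k H H :=
  Derivation.mk' ((TensorProduct.rid k H).toLinearMap ∘ₗ d.lTensor H ∘ₗ Coalgebra.comul) <| by
    let R : H ⊗[k] H →ₗ[k] H := (TensorProduct.rid k H).toLinearMap ∘ₗ d.lTensor H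
    let E : H ⊗[k] H →ₗ[k] H :=
      (TensorProduct.rid k H).toLinearMap ∘ₗ (Coalgebra.counit (R := k) (A := H)).lTensor H
    -- Since `E` composed with comultiplication is the identity, this specialises to the Leibniz
    -- rule.
    have key : ∀ s t : H ⊗[k] H, R (s * t) = E s * R t + E t * R s := by
      intro s t
      induction s with
      | zero => simp
      | add s₁ s₂ h₁ h₂ => simp only [add_mul, map_add, h₁, h₂, mul_add]; ring
      | tmul a b =>
        induction t with
        | zero => simp
        | add s₁ s₂ h₁ h₂ => simp only [add_mul, map_add, h₁, h₂, mul_add]; ring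
        | tmul a' b' =>
          simp only [R, E, LinearMap.comp_apply, Algebra.TensorProduct.tmul_mul_tmul,
            LinearMap.lTensor_tmul, LinearEquiv.coe_coe, TensorProduct.rid_tmul, hd,
            Algebra.smul_def, map_add, map_mul]
          ring
    have hE : ∀ a : H, E (Coalgebra.comul a) = a := by
      intro a
      simp [E]
    intro a b
    have := key (Coalgebra.comul a) (Coalgebra.comul b)
    rw [hE, hE, ← Bialgebra.comul_mul] at this
    exact this

/-- By the counit axiom the invariant extension of `d` has value `d` at the counit, so duality can
be arranged on point derivations. -/
theorem counit_invariantDerivation (d : H →ₗ[k] k)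
    (hd : ∀ a b, d (a * b) = Coalgebra.counit (R := k) a * d b + Coalgebra.counit (R := k) b * d a)
    (h : H) : Coalgebra.counit (R := k) (invariantDerivation d hd h) = d h := by
  have key : ∀ t : H ⊗[k] H, Coalgebra.counit (R := k) (TensorProduct.rid k H (d.lTensor H t)) =
      d (TensorProduct.lid k H ((Coalgebra.counit (R := k) (A := H)).rTensor H t)) := by
    intro t
    induction t with
    | zero => simp
    | add s₁ s₂ h₁ h₂ => simp only [map_add, h₁, h₂]
    | tmul a b => simp [mul_comm]
  refine (key (Coalgebra.comul h)).trans ?_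
  simp

/-- Elements of the augmentation ideal which are linearly independent modulo its square admit dual
derivations. -/
theorem exists_dual_derivations {ι : Type*} [Fintype ι] [DecidableEq ι] (x : ι → H)
    (hx : ∀ i, x i ∈ augIdeal k H) (T : ι → Prop)
    (hind : ∀ c : ι → k, (∀ i, ¬ T i → c i = 0) → ∑ i, c i • x i ∈ augIdeal k H ^ 2 → c = 0) :
    ∃ D : ι → Derivation k H H, ∀ i j, T i → T j →
      Coalgebra.counit (R := k) (D i (x j)) = if i = j then 1 else 0 := by
  classical
  let Q := H ⧸ (augIdeal k H ^ 2).restrictScalars k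
  let q : H →ₗ[k] Q := ((augIdeal k H ^ 2).restrictScalars k).mkQ
  have hq : ∀ y ∈ augIdeal k H ^ 2, q y = 0 := fun y hy =>
    (Submodule.Quotient.mk_eq_zero ((augIdeal k H ^ 2).restrictScalars k)).2 hy
  have hli : LinearIndependent k (fun i : {i // T i} => q (x i)) := by
    rw [Fintype.linearIndependent_iff]
    intro g hg i
    have := hind (fun i => if h : T i then g ⟨i, h⟩ else 0) (fun i hi => by simp [hi]) (by
      rw [← Submodule.restrictScalars_mem k, ← Submodule.Quotient.mk_eq_zero]
      change q _ = 0
      rw [map_sum, ← hg, ← Finset.sum_filter_of_ne (p := T)]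
      · rw [Finset.sum_subtype (Finset.univ.filter T) (p := T) (by simp)]
        exact Finset.sum_congr rfl fun j _ => by simp [j.2]
      · intro j _ hj
        by_contra h
        simp [h] at hj)
    simpa [i.2] using congrFun this i
  have hdual : ∀ i : {i // T i}, ∃ φ : Q →ₗ[k] k, ∀ j : {i // T i},
      φ (q (x j)) = if i = j then 1 else 0 := by
    intro i
    obtain ⟨g, hg⟩ := LinearMap.exists_leftInverse_of_injective
      (Finsupp.linearCombination k (fun i : {i // T i} => q (x i))) (LinearMap.ker_eq_bot.2 hli)
    refine ⟨Finsupp.lapply i ∘ₗ g, fun j => ?_⟩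
    have := LinearMap.congr_fun hg (Finsupp.single j 1)
    simp at this
    simp [this, Finsupp.single_apply, eq_comm]
  choose φ hφ using hdual
  -- Subtracting the constant part of `h` lands in `m`; a functional vanishing on `m²` is then a
  -- point derivation.
  let d : {i // T i} → H →ₗ[k] k := fun i =>
    φ i ∘ₗ q ∘ₗ (LinearMap.id - Algebra.linearMap k H ∘ₗ Coalgebra.counit)
  have hd : ∀ i a b, d i (a * b) =
      Coalgebra.counit (R := k) a * d i b + Coalgebra.counit (R := k) b * d i a := by
    intro i a b
    let δ : H → H := fun a => a - algebraMap k H (Coalgebra.counit a)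
    have hδ : ∀ a, δ a ∈ augIdeal k H := fun a => by simp [δ]
    have h1 : δ (a * b) = δ a * δ b + (Coalgebra.counit (R := k) a • δ b +
        Coalgebra.counit (R := k) b • δ a) := by
      simp only [δ, Bialgebra.counit_mul, map_mul, Algebra.smul_def]
      ring
    change φ i (q (δ (a * b))) = _ * φ i (q (δ b)) + _ * φ i (q (δ a))
    rw [h1, map_add, hq _ (by rw [pow_two]; exact Ideal.mul_mem_mul (hδ a) (hδ b)), zero_add]
    simp
  refine ⟨fun i => if h : T i then invariantDerivation (d ⟨i, h⟩) (hd ⟨i, h⟩) else 0,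
    fun i j hi hj => ?_⟩
  simp only [dif_pos hi]
  rw [counit_invariantDerivation]
  have : Coalgebra.counit (R := k) (x j) = 0 := hx j
  simp only [d, LinearMap.comp_apply, LinearMap.sub_apply, LinearMap.id_apply, this, map_zero,
    sub_zero]
  exact (hφ ⟨i, hi⟩ ⟨j, hj⟩).trans (by simp)

end Bialgebra

/-! ### The quotient by the kernel of Frobenius. -/

section FrobeniusKernel

variable {k : Type u} [Field k] (p : ℕ) [Fact p.Prime] [CharP k p]

theorem charP_of_nontrivial_algebra (k : Type u) [Field k] (p : ℕ) [CharP k p] (A : Type v)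
    [CommRing A] [Algebra k A] [Nontrivial A] : CharP A p :=
  charP_of_injective_algebraMap (algebraMap k A).injective p

theorem nontrivial_of_bialgebra (k : Type u) [Field k] (H : Type v) [CommRing H] [Bialgebra k H] :
    Nontrivial H :=
  (Bialgebra.counitAlgHom k H).toRingHom.domain_nontrivial

theorem charP_of_bialgebra (k : Type u) [Field k] (p : ℕ) [CharP k p] (H : Type v) [CommRing H]
    [Bialgebra k H] : CharP H p :=
  haveI := nontrivial_of_bialgebra k H
  charP_of_nontrivial_algebra k p H

/-- Over a perfect field, the kernel of the Frobenius map of `A ⊗ A` vanishes in the tensor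
square of the quotient of `A` by the kernel of Frobenius. -/
theorem map_mk_frobeniusKer_eq_zero [PerfectField k] {A : Type v} [CommRing A] [Algebra k A]
    [CharP A p] [Nontrivial (A ⊗[k] A)] {z : A ⊗[k] A} (hz : z ^ p = 0) :
    Algebra.TensorProduct.map (Ideal.Quotient.mkₐ k (RingHom.ker (frobenius A p)))
      (Ideal.Quotient.mkₐ k (RingHom.ker (frobenius A p))) z = 0 := by
  classical
  have : CharP (A ⊗[k] A) p := charP_of_nontrivial_algebra k p _
  have : PerfectRing k p := PerfectField.toPerfectRing p
  set I := RingHom.ker (frobenius A p) with hI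
  have hmem : ∀ y, y ∈ I ↔ y ^ p = 0 := fun y => Iff.rfl
  set π := Ideal.Quotient.mkₐ k I with hπ
  have hπs : Function.Surjective π := Ideal.Quotient.mkₐ_surjective k I
  have hπ0 : ∀ y, π y = 0 ↔ y ^ p = 0 := fun y => Ideal.Quotient.eq_zero_iff_mem.trans (hmem y)
  let e := Module.Basis.ofVectorSpace k (A ⧸ I)
  choose f hf using fun i => hπs (e i)
  -- Perfectness enters here: with `p`-th roots of the scalars, a relation between the `f i ^ p`
  -- says that a combination of the `f i` lies in the kernel of Frobenius, so it is trivial in the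
  -- quotient.
  have hli : LinearIndependent k (fun i => f i ^ p) := by
    rw [linearIndependent_iff']
    intro s g hg i hi
    choose c hc using fun i => surjective_frobenius k p (g i)
    have h1 : (∑ i ∈ s, c i • f i) ^ p = 0 := by
      rw [sum_pow_char, ← hg]
      refine Finset.sum_congr rfl fun j _ => ?_
      rw [smul_pow, ← frobenius_def, hc]
    rw [← hπ0, map_sum] at h1
    simp only [map_smul, hf] at h1
    rw [← hc, (linearIndependent_iff'.1 e.linearIndependent) s c h1 i hi, map_zero]
  have hker : ∀ y, Algebra.TensorProduct.map π π y = 0 → y ^ p = 0 := by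
    intro y hy
    have h1 : y ∈ RingHom.ker (Algebra.TensorProduct.map π π) := hy
    rw [Algebra.TensorProduct.map_ker π π hπs hπs] at h1
    have h2 : Ideal.map (Algebra.TensorProduct.includeLeft : A →ₐ[k] A ⊗[k] A) (RingHom.ker π) ⊔
        Ideal.map (Algebra.TensorProduct.includeRight : A →ₐ[k] A ⊗[k] A) (RingHom.ker π) ≤
        RingHom.ker (frobenius (A ⊗[k] A) p) := by
      refine sup_le (Ideal.map_le_iff_le_comap.2 fun a ha => ?_)
        (Ideal.map_le_iff_le_comap.2 fun a ha => ?_)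
      · have := (hπ0 a).1 ha
        simp [Ideal.mem_comap, RingHom.mem_ker, frobenius_def, this,
          Algebra.TensorProduct.tmul_pow]
      · have := (hπ0 a).1 ha
        simp [Ideal.mem_comap, RingHom.mem_ker, frobenius_def, this,
          Algebra.TensorProduct.tmul_pow]
    exact h2 h1
  obtain ⟨c, hc⟩ := TensorProduct.eq_repr_basis_left e (Algebra.TensorProduct.map π π z)
  choose d hd using fun i => hπs (c i)
  -- `z'` lifts the image of `z`, and Frobenius kills the kernel of `π ⊗ π`; hence `z' ^ p = 0`, and
  -- independence of the `f i ^ p` forces every `d i ^ p = 0`.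
  set z' := ∑ i ∈ c.support, f i ⊗ₜ[k] d i with hz'
  have h1 : Algebra.TensorProduct.map π π (z - z') = 0 := by
    rw [map_sub, ← hc, hz', map_sum, Finsupp.sum, sub_eq_zero]
    simp [hf, hd]
  have h2 : z' ^ p = 0 := by
    have := hker _ h1
    rwa [sub_pow_char, hz, zero_sub, neg_eq_zero] at this
  have h3 : ∑ i ∈ c.support, (f i ^ p) ⊗ₜ[k] (d i ^ p) = 0 := by
    rw [← h2, hz', sum_pow_char]
    simp [Algebra.TensorProduct.tmul_pow]
  obtain ⟨g, hg⟩ := LinearMap.exists_leftInverse_of_injective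
    (Finsupp.linearCombination k (fun i => f i ^ p)) (LinearMap.ker_eq_bot.2 hli)
  have hgi : ∀ i, g (f i ^ p) = Finsupp.single i 1 := fun i => by
    simpa using LinearMap.congr_fun hg (Finsupp.single i 1)
  rw [← hc]
  refine Finset.sum_eq_zero fun i hi => ?_
  have h4 := congrArg (fun y => TensorProduct.lid k A
    (LinearMap.rTensor A (Finsupp.lapply i ∘ₗ g) y)) h3
  simp only [map_sum, LinearMap.rTensor_tmul, LinearMap.comp_apply, hgi, Finsupp.lapply_apply,
    TensorProduct.lid_tmul, map_zero, Finsupp.single_apply, ite_smul, one_smul, zero_smul] at h4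
  rw [Finset.sum_ite_eq' c.support i, if_pos hi, ← hπ0, hd] at h4
  exact (congrArg (fun y => e i ⊗ₜ[k] y) h4).trans (TensorProduct.tmul_zero _ _)

/-- This makes `H / ker Frobenius` a bialgebra, so the induction on Frobenius exponents can pass to
it. -/
theorem isCoideal_frobeniusKer [PerfectField k] (H : Type v) [CommRing H] [Bialgebra k H]
    [CharP H p] :
    ((RingHom.ker (frobenius H p)).restrictScalars k).IsCoideal where
  counit_eq_zero x hx := by
    have h1 : x ^ p = 0 := hx
    have h2 := congrArg (Bialgebra.counitAlgHom k H) h1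
    rw [map_pow, map_zero] at h2
    exact eq_zero_of_pow_eq_zero h2
  map_mkQ_comul_eq_zero x hx := by
    have h1 : x ^ p = 0 := hx
    have := nontrivial_of_bialgebra k H
    have : Nontrivial (H ⊗[k] H) :=
      (Algebra.TensorProduct.lmul' k : H ⊗[k] H →ₐ[k] H).toRingHom.domain_nontrivial
    refine map_mk_frobeniusKer_eq_zero p (z := Coalgebra.comul x) ?_
    rw [← Bialgebra.comul_pow, h1, map_zero]

end FrobeniusKernel

/-! ### Independence of monomials over `p ^ M`-th powers. -/

section Adapted

/-- The exponents `a` with `a i < p ^ e i`. -/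
def box {ι : Type*} [Fintype ι] [DecidableEq ι] (p : ℕ) (e : ι → ℕ) : Finset (ι → ℕ) :=
  Fintype.piFinset fun i => Finset.range (p ^ e i)

theorem mem_box {ι : Type*} [Fintype ι] [DecidableEq ι] {p : ℕ} {e : ι → ℕ} {a : ι → ℕ} :
    a ∈ box p e ↔ ∀ i, a i < p ^ e i := by
  simp [box]

theorem mod_mem_box {ι : Type*} [Fintype ι] [DecidableEq ι] {p : ℕ} (hp : 0 < p) {e : ι → ℕ}
    {a : ι → ℕ} (ha : a ∈ box p e) : (fun i => a i % p) ∈ box p (fun i => min (e i) 1) := by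
  refine mem_box.2 fun i => ?_
  have := mem_box.1 ha i
  rcases Nat.eq_zero_or_pos (e i) with h0 | h0
  · simp [h0] at this ⊢
    simp [this]
  · rw [min_eq_right h0, pow_one]
    exact Nat.mod_lt _ hp

theorem div_mem_box {ι : Type*} [Fintype ι] [DecidableEq ι] {p : ℕ} (hp : 0 < p) {e : ι → ℕ}
    {a : ι → ℕ} (ha : a ∈ box p e) : (fun i => a i / p) ∈ box p (fun i => e i - 1) := by
  refine mem_box.2 fun i => ?_
  have := mem_box.1 ha i
  rcases Nat.eq_zero_or_pos (e i) with h0 | h0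
  · simp [h0] at this ⊢
    exact Or.inr (by omega)
  · rwa [Nat.div_lt_iff_lt_mul hp, ← pow_succ, Nat.sub_add_cancel h0]

/-- Exponents are split into the last base-`p` digit and the rest. Where `e i = 0` both parts are
zero, which `min (e i) 1` and the truncated `e i - 1` encode. -/
theorem sum_box_eq_sum_sum {ι : Type*} [Fintype ι] [DecidableEq ι] {p : ℕ} (hp : 0 < p)
    (e : ι → ℕ) {A : Type*} [AddCommMonoid A] (F : (ι → ℕ) → A) :
    ∑ a ∈ box p e, F a =
      ∑ b ∈ box p (fun i => min (e i) 1), ∑ a ∈ box p (fun i => e i - 1), F (b + p • a) := by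
  rw [← Finset.sum_product']
  symm
  refine Finset.sum_nbij' (fun y => y.1 + p • y.2)
    (fun a => (fun i => a i % p, fun i => a i / p)) ?_ ?_ ?_ ?_ ?_
  · rintro ⟨b, a⟩ h
    simp only [Finset.mem_product, mem_box] at h ⊢
    intro i
    obtain ⟨h1, h2⟩ := And.intro (h.1 i) (h.2 i)
    simp only [Pi.add_apply, Pi.smul_apply, smul_eq_mul]
    rcases Nat.eq_zero_or_pos (e i) with h0 | h0
    · simp [h0] at h1 h2 ⊢
      simp [h1, h2]
    · rw [min_eq_right h0, pow_one] at h1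
      rw [← Nat.sub_add_cancel h0, pow_succ']
      nlinarith
  · intro a h
    exact Finset.mem_product.2 ⟨mod_mem_box hp h, div_mem_box hp h⟩
  · rintro ⟨b, a⟩ h
    simp only [Finset.mem_product, mem_box] at h
    have hb : ∀ i, b i < p := fun i =>
      (h.1 i).trans_le ((Nat.pow_le_pow_right hp (min_le_right _ _)).trans (pow_one p).le)
    ext i
    · simp [Nat.mod_eq_of_lt (hb i)]
    · simp [Nat.add_mul_div_left _ _ hp, Nat.div_eq_of_lt (hb i)]
  · intro a _
    ext i
    simp [Nat.mod_add_div]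
  · intro _ _
    rfl

variable {k : Type u} [Field k] {p : ℕ} [Fact p.Prime]

/-- The family `x` is adapted to the exponents `e` if, for every `s`, the `x i` with `s < e i`
are linearly independent modulo `m ^ 2` and the elements killed by the `s`-th Frobenius power,
where `m` is the augmentation ideal. -/
def IsAdapted (k : Type u) [Field k] (p : ℕ) [Fact p.Prime] {H : Type v} [CommRing H]
    [Bialgebra k H] [CharP H p] {ι : Type*} [Fintype ι] (x : ι → H) (e : ι → ℕ) : Prop :=
  ∀ (s : ℕ) (c : ι → k), (∀ i, e i ≤ s → c i = 0) →
    ∑ i, c i • x i ∈ augIdeal k H ^ 2 ⊔ RingHom.ker (iterateFrobenius H p s) → c = 0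

/-- The level `s = 0` of adaptedness supplies derivations dual to the `x i` with `0 < e i`, and no
other `x i` occurs in these monomials. -/
theorem IsAdapted.exists_mul_pow_eq_zero_of_lt_char {H : Type v} [CommRing H] [Bialgebra k H]
    [CharP H p] {ι : Type*} [Fintype ι] [DecidableEq ι] {x : ι → H} {e : ι → ℕ}
    (hx : ∀ i, x i ∈ augIdeal k H) (hA : IsAdapted k p x e) (g : (ι → ℕ) → H)
    (h0 : ∑ b ∈ box p (fun i => min (e i) 1), g b ^ p * ∏ i, x i ^ b i = 0) :
    ∃ s, Coalgebra.counit (R := k) s = 1 ∧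
      ∀ b ∈ box p (fun i => min (e i) 1), (s * g b) ^ p = 0 := by
  have hp : 0 < p := (Fact.out : p.Prime).pos
  obtain ⟨D, hD⟩ := exists_dual_derivations x hx (fun i => 0 < e i) (fun c hc h => hA 0 c
    (fun i hi => hc i (by omega)) (Ideal.mem_sup_left h))
  set P : MvPolynomial ι H := ∑ b ∈ box p (fun i => min (e i) 1),
    MvPolynomial.monomial (Finsupp.equivFunOnFinite.symm b) (g b) with hP
  have hcoeff : ∀ b : ι →₀ ℕ, P.coeff b =
      if (b : ι → ℕ) ∈ box p (fun i => min (e i) 1) then g b else 0 := by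
    intro b
    rw [hP, MvPolynomial.coeff_sum]
    simp only [MvPolynomial.coeff_monomial]
    have : ∀ a : ι → ℕ, (Finsupp.equivFunOnFinite.symm a = b) ↔ a = b := fun a =>
      Equiv.symm_apply_eq _
    simp only [this]
    rw [Finset.sum_ite_eq']
  obtain ⟨s, hs1, hs2⟩ := exists_mul_coeff_pow_eq_zero (p := p)
    (Bialgebra.counitAlgHom k H : H →+* k) x
    (fun i => 0 < e i) D hD (P.support.sup Finsupp.degree) P (fun b hb => by
      refine ⟨Finset.le_sup (f := Finsupp.degree) (MvPolynomial.mem_support_iff.2 hb), fun i => ?_⟩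
      rw [hcoeff] at hb
      have h1 := mem_box.1 (not_not.1 fun h => hb (if_neg h)) i
      refine ⟨h1.trans_le ((Nat.pow_le_pow_right hp (min_le_right _ _)).trans (pow_one p).le),
        fun hi => ?_⟩
      have : e i = 0 := by omega
      simpa [this] using h1) (by
      rw [← h0, hP, MvPolynomial.eval₂_sum]
      refine Finset.sum_congr rfl fun b _ => ?_
      rw [MvPolynomial.eval₂_monomial, frobenius_def, Finsupp.prod_fintype _ _ (by simp)]
      rfl)
  refine ⟨s, hs1, fun b hb => ?_⟩
  have := hs2 (Finsupp.equivFunOnFinite.symm b)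
  rw [hcoeff] at this
  rwa [if_pos (by exact hb)] at this

/-- Monomials in an adapted family, with exponents bounded by `e`, are linearly independent over
`p ^ M`-th powers, up to multiplication by a function which does not vanish at the counit. -/
theorem exists_mul_pow_eq_zero_of_isAdapted [CharP k p] [PerfectField k] {ι : Type*} [Fintype ι]
    [DecidableEq ι] (M : ℕ) :
    ∀ (H : Type v) [CommRing H] [Bialgebra k H] [CharP H p] (x : ι → H) (e : ι → ℕ)
      (_ : ∀ i, x i ∈ augIdeal k H) (_ : ∀ i, e i ≤ M) (_ : IsAdapted k p x e) (c : (ι → ℕ) → H)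
      (_ : ∑ a ∈ box p e, c a ^ p ^ M * ∏ i, x i ^ a i = 0),
      ∃ s : H, Coalgebra.counit (R := k) s = 1 ∧ ∀ a ∈ box p e, (s * c a) ^ p ^ M = 0 := by
  have hp : 0 < p := (Fact.out : p.Prime).pos
  induction M with
  | zero =>
    intro H _ _ _ x e hx he hA c h0
    have hbox : ∀ a, a ∈ box p e ↔ a = 0 := by
      intro a
      simp [mem_box, Nat.le_zero.1 (he _), funext_iff]
    have hbox' : box p e = {0} := by
      ext a
      simp [hbox]
    refine ⟨1, by simp, fun a ha => ?_⟩
    rw [hbox', Finset.sum_singleton] at h0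
    rw [(hbox a).1 ha]
    simpa using h0
  | succ M ih =>
    intro H _ _ _ x e hx he hA c h0
    have hc : ((RingHom.ker (frobenius H p)).restrictScalars k).IsCoideal :=
      isCoideal_frobeniusKer p H
    let Q := H ⧸ RingHom.ker (frobenius H p)
    have hQ : CharP Q p := charP_of_bialgebra k p Q
    let π : H →ₐ[k] Q := Ideal.Quotient.mkₐ k (RingHom.ker (frobenius H p))
    have hπs : Function.Surjective π := Ideal.Quotient.mkₐ_surjective k _
    have hπ0 : ∀ y, π y = 0 ↔ y ^ p = 0 := fun y => Ideal.Quotient.eq_zero_iff_mem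
    have hπε : ∀ y, Coalgebra.counit (R := k) (π y) = Coalgebra.counit y := fun y => rfl
    -- Grouped by last digits `b`, the relation reads `∑ g b ^ p * x ^ b = 0`, the case already
    -- settled.
    let g : (ι → ℕ) → H := fun b =>
      ∑ a ∈ box p (fun i => e i - 1), c (b + p • a) ^ p ^ M * ∏ i, x i ^ a i
    obtain ⟨s₀, hs₀, hs₀'⟩ := hA.exists_mul_pow_eq_zero_of_lt_char hx g (by
      rw [sum_box_eq_sum_sum hp] at h0
      rw [← h0]
      refine Finset.sum_congr rfl fun b _ => ?_
      rw [sum_pow_char, Finset.sum_mul]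
      refine Finset.sum_congr rfl fun a _ => ?_
      rw [mul_pow, ← pow_mul, ← pow_succ, mul_assoc, ← Finset.prod_pow, ← Finset.prod_mul_distrib]
      congr 1
      refine Finset.prod_congr rfl fun i _ => ?_
      rw [← pow_mul, ← pow_add]
      congr 1
      simp only [Pi.add_apply, Pi.smul_apply, smul_eq_mul]
      ring)
    -- Level `s` on `Q` corresponds to level `s + 1` on `H`: an element killed by the `s`-th
    -- Frobenius power in `Q` lifts only to elements killed by the next one.
    have hA' : IsAdapted k p (fun i => π (x i)) (fun i => e i - 1) := by
      intro s d hd hmem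
      refine hA (s + 1) d (fun i hi => hd i (by
        show e i - 1 ≤ s
        omega)) ?_
      have h1 : Ideal.map π (augIdeal k H) = augIdeal k Q := by
        refine le_antisymm (Ideal.map_le_iff_le_comap.2 fun y hy => ?_) fun y hy => ?_
        · exact hy
        · obtain ⟨y, rfl⟩ := hπs y
          exact Ideal.mem_map_of_mem π hy
      have h2 : RingHom.ker (iterateFrobenius Q p s) ≤
          Ideal.map π (RingHom.ker (iterateFrobenius H p (s + 1))) := by
        intro y hy
        obtain ⟨y, rfl⟩ := hπs y
        refine Ideal.mem_map_of_mem π ?_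
        rw [RingHom.mem_ker, iterateFrobenius_def] at hy ⊢
        rw [← map_pow, hπ0, ← pow_mul, ← pow_succ] at hy
        exact hy
      have h3 : π (∑ i, d i • x i) ∈
          Ideal.map π (augIdeal k H ^ 2 ⊔ RingHom.ker (iterateFrobenius H p (s + 1))) := by
        rw [Ideal.map_sup, Ideal.map_pow, h1, map_sum]
        simp only [map_smul]
        exact (sup_le_sup le_rfl h2) hmem
      rw [Ideal.mem_map_iff_of_surjective π hπs] at h3
      obtain ⟨y, hy, hyx⟩ := h3
      have h4 : (∑ i, d i • x i) - y ∈ RingHom.ker (iterateFrobenius H p (s + 1)) := by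
        rw [RingHom.mem_ker, iterateFrobenius_def, pow_succ', pow_mul, (hπ0 _).1, zero_pow
          (pow_ne_zero _ hp.ne')]
        rw [map_sub, hyx, sub_self]
      have := Ideal.add_mem _ hy (Ideal.mem_sup_right (S := augIdeal k H ^ 2) h4)
      rwa [add_sub_cancel] at this
    have key : ∀ b ∈ box p (fun i => min (e i) 1), ∃ s, Coalgebra.counit (R := k) s = 1 ∧
        ∀ a ∈ box p (fun i => e i - 1), (s * (s₀ * c (b + p • a))) ^ p ^ (M + 1) = 0 := by
      intro b hb
      have h1 := (hπ0 _).2 (hs₀' b hb)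
      obtain ⟨s, hs, hs'⟩ := ih Q (fun i => π (x i)) (fun i => e i - 1) (fun i => hx i)
        (fun i => by have := he i; omega) hA' (fun a => π (s₀ * c (b + p • a))) (by
          -- Together with the factor `s₀` already present, this power absorbs `s₀` into the
          -- coefficients, which are raised to `p ^ M`.
          have h2 := congrArg (fun y => π s₀ ^ (p ^ M - 1) * y) h1
          simp only [mul_zero, g, map_mul, map_sum, map_pow, map_prod] at h2
          rw [← mul_assoc, ← pow_succ, Nat.sub_add_cancel (Nat.pow_pos hp), Finset.mul_sum] at h2
          rw [← h2]
          refine Finset.sum_congr rfl fun a _ => ?_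
          rw [map_mul, mul_pow, mul_assoc])
      obtain ⟨s, rfl⟩ := hπs s
      refine ⟨s, hs, fun a ha => ?_⟩
      have h3 := hs' a ha
      rw [← map_mul, ← map_pow, hπ0, ← pow_mul, ← pow_succ] at h3
      exact h3
    choose! s hs hs' using key
    refine ⟨s₀ * ∏ b ∈ box p (fun i => min (e i) 1), s b, ?_, fun a ha => ?_⟩
    · have : Coalgebra.counit (R := k) (∏ b ∈ box p (fun i => min (e i) 1), s b) = 1 := by
        have h1 := map_prod (Bialgebra.counitAlgHom k H) s (box p (fun i => min (e i) 1))
        exact h1.trans (Finset.prod_eq_one hs)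
      rw [Bialgebra.counit_mul, hs₀, this, one_mul]
    · have h1 : ∀ b ∈ box p (fun i => min (e i) 1), ∀ a ∈ box p (fun i => e i - 1),
          ((s₀ * ∏ b ∈ box p (fun i => min (e i) 1), s b) * c (b + p • a)) ^ p ^ (M + 1) = 0 := by
        intro b hb a ha
        rw [← Finset.mul_prod_erase _ _ hb,
          show ∀ t, s₀ * (s b * t) * c (b + p • a) = t * (s b * (s₀ * c (b + p • a))) by intro t; ring,
          mul_pow, hs' b hb a ha, mul_zero]
      have hab : (fun i => a i % p) + p • (fun i => a i / p) = a := by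
        ext i
        simp [Nat.mod_add_div]
      have := h1 _ (mod_mem_box hp ha) _ (div_mem_box hp ha)
      rwa [hab] at this

end Adapted

/-! ### Monomial bases modulo `p ^ M`-th powers of the augmentation ideal. -/

section FrobeniusPower

variable {k : Type u} [Field k] {p : ℕ}

/-- Each `x` is a root of `X ^ p ^ M - x` read through Frobenius, so the map is integral; it is of
finite type because Frobenius is surjective on `k`. -/
theorem iterateFrobenius_finite (k : Type u) [Field k] (p : ℕ) [Fact p.Prime] [CharP k p]
    [PerfectField k] (A : Type v) [CommRing A] [Algebra k A] [CharP A p] [Algebra.FiniteType k A]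
    (M : ℕ) : (iterateFrobenius A p M).Finite := by
  have : PerfectRing k p := PerfectField.toPerfectRing p
  refine RingHom.IsIntegral.to_finite (fun x => ?_) ?_
  · refine ⟨Polynomial.X ^ p ^ M - Polynomial.C x, ?_, ?_⟩
    · exact Polynomial.monic_X_pow_sub_C x (pow_ne_zero _ (Fact.out : p.Prime).ne_zero)
    · simp [iterateFrobenius_def]
  · refine RingHom.FiniteType.of_comp_finiteType (f := algebraMap k A) ?_
    rw [← RingHom.iterateFrobenius_comm]
    refine RingHom.FiniteType.comp ?_ (RingHom.FiniteType.of_surjective _ ?_)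
    · exact (RingHom.finiteType_algebraMap).2 inferInstance
    · exact (iterateFrobeniusEquiv k p M).surjective

/-- A form of Nakayama's lemma along a finite ring homomorphism. -/
theorem exists_mul_mem_span_of_finite {R : Type v} {S : Type w} [CommRing R] [CommRing S]
    (φ : R →+* S) (hφ : φ.Finite) (I : Ideal R) {α : Type*} (s : Finset α) (y : α → S)
    (hy : ∀ h : S, ∃ c : α → R, h - ∑ a ∈ s, φ (c a) * y a ∈ I.map φ) :
    ∃ r, r - 1 ∈ I ∧ ∀ h : S, ∃ c : α → R, φ r * h = ∑ a ∈ s, φ (c a) * y a := by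
  classical
  let _ := φ.toAlgebra
  have hfin : Module.Finite R S := hφ
  obtain ⟨r, hr, hr'⟩ := Submodule.exists_sub_one_mem_and_smul_le_of_fg_of_le_sup (I := I)
    (N := Submodule.span R (y '' s)) (N' := (⊤ : Submodule R S)) (P := ⊤) hfin.1 le_rfl (by
      intro h _
      obtain ⟨c, hc⟩ := hy h
      rw [← sub_add_cancel h (∑ a ∈ s, φ (c a) * y a), add_comm]
      refine Submodule.add_mem_sup (Submodule.sum_mem _ fun a ha => ?_) ?_
      · exact Submodule.smul_mem _ (c a) (Submodule.subset_span ⟨a, ha, rfl⟩)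
      · rw [Ideal.smul_top_eq_map]
        exact hc)
  refine ⟨r, hr, fun h => ?_⟩
  have h1 : r • h ∈ Submodule.span R (y '' s) :=
    hr' (Submodule.smul_mem_pointwise_smul h r ⊤ trivial)
  rw [Submodule.mem_span_image_finset_iff_exists_fun'] at h1
  obtain ⟨c, hc⟩ := h1
  exact ⟨c, hc.symm⟩

/-- The ideal generated by the `p ^ M`-th powers of elements of the augmentation ideal. -/
noncomputable abbrev augFrobPow (k : Type u) [Field k] (p : ℕ) [Fact p.Prime] (H : Type v)
    [CommRing H] [Bialgebra k H] [CharP H p] (M : ℕ) : Ideal H :=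
  (augIdeal k H).map (iterateFrobenius H p M)

variable {H : Type v} [CommRing H] [Bialgebra k H]

/-- Successive approximation: in a product of two elements of `m`, each error term gains one further
factor from `m`. This is why the approximants are also kept in `m`. -/
theorem exists_sub_aeval_mem_pow {ι : Type*} [Fintype ι] (x : ι → H)
    (hx : ∀ i, x i ∈ augIdeal k H)
    (hgen : ∀ y ∈ augIdeal k H, ∃ c : ι → k, y - ∑ i, c i • x i ∈ augIdeal k H ^ 2) (n : ℕ) :
    ∀ y ∈ augIdeal k H, ∃ P : MvPolynomial ι k, MvPolynomial.aeval x P ∈ augIdeal k H ∧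
      y - MvPolynomial.aeval x P ∈ augIdeal k H ^ (n + 1) := by
  induction n with
  | zero => exact fun y hy => ⟨0, by simp, by simpa using hy⟩
  | succ n ih =>
    intro y hy
    have h2 : ∀ z ∈ augIdeal k H ^ 2, ∃ P : MvPolynomial ι k,
        MvPolynomial.aeval x P ∈ augIdeal k H ∧
        z - MvPolynomial.aeval x P ∈ augIdeal k H ^ (n + 2) := by
      intro z hz
      rw [pow_two] at hz
      induction hz using Submodule.mul_induction_on' with
      | mem_mul_mem a ha b hb =>
        obtain ⟨P, hP, hP'⟩ := ih a ha
        obtain ⟨Q, hQ, hQ'⟩ := ih b hb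
        refine ⟨P * Q, ?_, ?_⟩
        · rw [map_mul]
          exact Ideal.mul_mem_left _ _ hQ
        · rw [map_mul, show a * b - MvPolynomial.aeval x P * MvPolynomial.aeval x Q =
            (b - MvPolynomial.aeval x Q) * a +
              (a - MvPolynomial.aeval x P) * MvPolynomial.aeval x Q by ring, pow_succ]
          exact Ideal.add_mem _ (Ideal.mul_mem_mul hQ' ha) (Ideal.mul_mem_mul hP' hQ)
      | add a _ b _ ha hb =>
        obtain ⟨P, hP, hP'⟩ := ha
        obtain ⟨Q, hQ, hQ'⟩ := hb
        refine ⟨P + Q, ?_, ?_⟩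
        · rw [map_add]
          exact Ideal.add_mem _ hP hQ
        · rw [map_add, add_sub_add_comm]
          exact Ideal.add_mem _ hP' hQ'
    obtain ⟨c, hc⟩ := hgen y hy
    obtain ⟨P, hP, hP'⟩ := h2 _ hc
    refine ⟨∑ i, c i • MvPolynomial.X i + P, ?_, ?_⟩
    · simp only [map_add, map_sum, map_smul, MvPolynomial.aeval_X]
      refine Ideal.add_mem _ (Ideal.sum_mem _ fun i _ => ?_) hP
      rw [Algebra.smul_def]
      exact Ideal.mul_mem_left _ _ (hx i)
    · simp only [map_add, map_sum, map_smul, MvPolynomial.aeval_X]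
      rwa [← sub_sub]

theorem aeval_eq_sum_box {ι : Type*} [Fintype ι] [DecidableEq ι] {A : Type w} [CommRing A]
    [Algebra k A] {y : ι → A} {e : ι → ℕ} (hy : ∀ i, y i ^ p ^ e i = 0) (P : MvPolynomial ι k) :
    MvPolynomial.aeval y P =
      ∑ a ∈ box p e, P.coeff (Finsupp.equivFunOnFinite.symm a) • ∏ i, y i ^ a i := by
  induction P using MvPolynomial.induction_on' with
  | monomial d r =>
    rw [MvPolynomial.aeval_monomial, Finsupp.prod_fintype _ _ (by simp)]
    have hd : ∀ a : ι → ℕ, d = Finsupp.equivFunOnFinite.symm a ↔ (d : ι → ℕ) = a := fun a =>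
      Equiv.eq_symm_apply _
    simp only [MvPolynomial.coeff_monomial, hd, ite_smul, zero_smul]
    rw [Finset.sum_ite_eq]
    split_ifs with h
    · rw [Algebra.smul_def]
    · simp only [mem_box, not_forall, not_lt] at h
      obtain ⟨i, hi⟩ := h
      have h1 : y i ^ d i = 0 := pow_eq_zero_of_le hi (hy i)
      rw [Finset.prod_eq_zero (Finset.mem_univ i) h1, mul_zero]
  | add P Q hP hQ =>
    simp only [map_add, hP, hQ, MvPolynomial.coeff_add, add_smul, Finset.sum_add_distrib]

/-- Generators of the augmentation ideal modulo its square generate the algebra modulo any ideal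
whose radical contains the augmentation ideal. -/
theorem exists_sub_sum_box_mem [IsNoetherianRing H] {ι : Type*} [Fintype ι] [DecidableEq ι]
    (x : ι → H) (hx : ∀ i, x i ∈ augIdeal k H)
    (hgen : ∀ y ∈ augIdeal k H, ∃ c : ι → k, y - ∑ i, c i • x i ∈ augIdeal k H ^ 2)
    (J : Ideal H) (hJ : augIdeal k H ≤ J.radical) (e : ι → ℕ) (hxJ : ∀ i, x i ^ p ^ e i ∈ J)
    (h : H) : ∃ c : (ι → ℕ) → k, h - ∑ a ∈ box p e, c a • ∏ i, x i ^ a i ∈ J := by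
  obtain ⟨n, hn⟩ := Ideal.exists_pow_le_of_le_radical_of_fg hJ (IsNoetherian.noetherian _)
  have h1 : ∃ P : MvPolynomial ι k, h - MvPolynomial.aeval x P ∈ J := by
    obtain ⟨P, -, hP⟩ := exists_sub_aeval_mem_pow x hx hgen n
      (h - algebraMap k H (Coalgebra.counit h)) (by simp)
    refine ⟨MvPolynomial.C (Coalgebra.counit h) + P, hn (Ideal.pow_le_pow_right n.le_succ ?_)⟩
    rwa [map_add, MvPolynomial.aeval_C, ← sub_sub]
  obtain ⟨P, hP⟩ := h1
  refine ⟨fun a => P.coeff (Finsupp.equivFunOnFinite.symm a), ?_⟩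
  have h2 := aeval_eq_sum_box (p := p) (y := fun i => Ideal.Quotient.mkₐ k J (x i)) (e := e)
    (fun i => by
      rw [← map_pow]
      exact Ideal.Quotient.eq_zero_iff_mem.2 (hxJ i)) P
  have h3 : Ideal.Quotient.mkₐ k J (MvPolynomial.aeval x P) =
      MvPolynomial.aeval (fun i => Ideal.Quotient.mkₐ k J (x i)) P :=
    (MvPolynomial.comp_aeval_apply x (Ideal.Quotient.mkₐ k J) P)
  have h4 : Ideal.Quotient.mkₐ k J (h - MvPolynomial.aeval x P) = 0 :=
    Ideal.Quotient.eq_zero_iff_mem.2 hP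
  refine Ideal.Quotient.eq_zero_iff_mem.1 (?_ : Ideal.Quotient.mkₐ k J _ = 0)
  rw [map_sub, h3, h2] at h4
  simpa only [map_sub, map_sum, map_smul, map_prod, map_pow] using h4

variable [Fact p.Prime] [CharP H p]

theorem augIdeal_le_radical_augFrobPow (M : ℕ) :
    augIdeal k H ≤ (augFrobPow k p H M).radical := fun _ hx =>
  ⟨p ^ M, Ideal.mem_map_of_mem (iterateFrobenius H p M) hx⟩

variable [CharP k p] [PerfectField k]

/-- The monomials with exponents in the box are linearly independent modulo the ideal generated by
the `p ^ M`-th powers of the augmentation ideal. -/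
theorem coeff_eq_zero_of_sum_box_mem_augFrobPow [Algebra.FiniteType k H] {ι : Type*} [Fintype ι]
    [DecidableEq ι] (x : ι → H) (hx : ∀ i, x i ∈ augIdeal k H)
    (hgen : ∀ y ∈ augIdeal k H, ∃ c : ι → k, y - ∑ i, c i • x i ∈ augIdeal k H ^ 2)
    (M : ℕ) (e : ι → ℕ) (he : ∀ i, e i ≤ M) (hxJ : ∀ i, x i ^ p ^ e i ∈ augFrobPow k p H M)
    (hA : IsAdapted k p x e) (c : (ι → ℕ) → k)
    (hc : ∑ a ∈ box p e, c a • ∏ i, x i ^ a i ∈ augFrobPow k p H M) :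
    ∀ a ∈ box p e, c a = 0 := by
  have hnoeth : IsNoetherianRing H := Algebra.FiniteType.isNoetherianRing k H
  have : PerfectRing k p := PerfectField.toPerfectRing p
  -- Scalars are rewritten as `p ^ M`-th powers so that they can serve as coefficients acting
  -- through Frobenius.
  choose r hr using fun c : k => (iterateFrobeniusEquiv k p M).surjective c
  have hr' : ∀ c : k, iterateFrobenius H p M (algebraMap k H (r c)) = algebraMap k H c := by
    intro c
    rw [iterateFrobenius_def, ← map_pow, ← iterateFrobeniusEquiv_def, hr]
  obtain ⟨s, hs, hs'⟩ := exists_mul_mem_span_of_finite (iterateFrobenius H p M)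
    (iterateFrobenius_finite k p H M) (augIdeal k H) (box p e) (fun a => ∏ i, x i ^ a i) (by
      intro h
      obtain ⟨c, hc⟩ := exists_sub_sum_box_mem (p := p) x hx hgen (augFrobPow k p H M)
        (augIdeal_le_radical_augFrobPow M) e hxJ h
      refine ⟨fun a => algebraMap k H (r (c a)), ?_⟩
      simpa only [hr', ← Algebra.smul_def] using hc)
  have hsε : Coalgebra.counit (R := k) s = 1 := by
    rw [mem_augIdeal, map_sub, sub_eq_zero, Bialgebra.counit_one] at hs
    exact hs
  -- After multiplication by `s ^ p ^ M`, elements of `J_M` expand in the monomials with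
  -- coefficients that are Frobenius powers of elements of `m`.
  have key : ∀ j ∈ augFrobPow k p H M, ∀ h, ∃ d : (ι → ℕ) → H, (∀ a, d a ∈ augIdeal k H) ∧
      iterateFrobenius H p M s * (h * j) =
        ∑ a ∈ box p e, iterateFrobenius H p M (d a) * ∏ i, x i ^ a i := by
    intro j hj
    induction hj using Submodule.span_induction with
    | mem j hj =>
      obtain ⟨y, hy, rfl⟩ := hj
      intro h
      obtain ⟨d, hd⟩ := hs' h
      refine ⟨fun a => y * d a, fun a => Ideal.mul_mem_right _ _ hy, ?_⟩
      rw [← mul_assoc, hd, Finset.sum_mul]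
      refine Finset.sum_congr rfl fun a _ => ?_
      rw [map_mul]
      ring
    | zero => exact fun h => ⟨0, by simp, by simp⟩
    | add j j' _ _ hj hj' =>
      intro h
      obtain ⟨d, hd, hd'⟩ := hj h
      obtain ⟨f, hf, hf'⟩ := hj' h
      refine ⟨d + f, fun a => Ideal.add_mem _ (hd a) (hf a), ?_⟩
      rw [mul_add, mul_add, hd', hf', ← Finset.sum_add_distrib]
      refine Finset.sum_congr rfl fun a _ => ?_
      rw [Pi.add_apply, map_add, add_mul]
    | smul b j _ hj =>
      intro h
      obtain ⟨d, hd, hd'⟩ := hj (h * b)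
      exact ⟨d, hd, by rw [← hd', smul_eq_mul]; ring⟩
  obtain ⟨d, hd, hd'⟩ := key _ hc 1
  -- Two expansions of one element are compared. The counit has value 1 on `s` and `s'` and 0 on `d
  -- a`, so it sends the resulting nilpotent to `r (c a)`.
  obtain ⟨s', hs1, hs2⟩ := exists_mul_pow_eq_zero_of_isAdapted (k := k) M H x e hx he hA
    (fun a => s * algebraMap k H (r (c a)) - d a) (by
      rw [one_mul, Finset.mul_sum, ← sub_eq_zero, ← Finset.sum_sub_distrib] at hd'
      rw [← hd']
      refine Finset.sum_congr rfl fun a _ => ?_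
      rw [← iterateFrobenius_def, map_sub, map_mul, hr', Algebra.smul_def]
      ring)
  intro a ha
  have h1 := congrArg (Bialgebra.counitAlgHom k H) (hs2 a ha)
  have hda : Coalgebra.counit (R := k) (d a) = 0 := hd a
  have h2 : r (c a) = 0 := by
    have := eq_zero_of_pow_eq_zero ((map_pow _ _ _).symm.trans (h1.trans (map_zero _)))
    simpa [hs1, hsε, hda] using this
  rw [← hr (c a), h2, map_zero]

end FrobeniusPower

/-! ### Bases adapted to a flag. -/

section Flag

variable {k : Type u} {V : Type v} [Field k] [AddCommGroup V] [Module k V]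

/-- A basis of `W M` is extended to one of `W (M + 1)`, and `e` records the level at which a vector
was added. -/
theorem exists_linearIndepOn_span_eq (W : ℕ → Submodule k V) (hW : Monotone W) (h0 : W 0 = ⊥)
    (M : ℕ) : ∃ (B : Set V) (e : V → ℕ), LinearIndepOn k id B ∧ B ⊆ W M ∧ (∀ v ∈ B, e v ≤ M) ∧
      ∀ s ≤ M, Submodule.span k {v ∈ B | e v ≤ s} = W s := by
  classical
  induction M with
  | zero =>
    refine ⟨∅, fun _ => 0, linearIndepOn_empty _ _, Set.empty_subset _, by simp, fun s hs => ?_⟩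
    rw [Nat.le_zero.1 hs, h0]
    simp
  | succ M ih =>
    obtain ⟨B, e, hB, hBW, heM, hspan⟩ := ih
    have hsub : B ⊆ W (M + 1) := hBW.trans (hW M.le_succ)
    refine ⟨hB.extend hsub, fun v => if v ∈ B then e v else M + 1, hB.linearIndepOn_extend hsub,
      hB.extend_subset hsub, fun v _ => ?_, fun s hs => ?_⟩
    · dsimp only
      split_ifs with h
      · exact (heM v h).trans M.le_succ
      · exact le_rfl
    · rcases Nat.lt_or_ge s (M + 1) with hs' | hs'
      · rw [← hspan s (by omega)]
        congr 1
        ext v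
        simp only [Set.mem_ofPred_eq]
        constructor
        · rintro ⟨-, h⟩
          split_ifs at h with hv
          · exact ⟨hv, h⟩
          · omega
        · rintro ⟨hv, h⟩
          exact ⟨hB.subset_extend hsub hv, by rwa [if_pos hv]⟩
      · obtain rfl : s = M + 1 := by omega
        have h1 : {v ∈ hB.extend hsub | (if v ∈ B then e v else M + 1) ≤ M + 1} =
            hB.extend hsub := by
          ext v
          simp only [Set.mem_ofPred_eq, and_iff_left_iff_imp]
          intro _
          split_ifs with h
          · exact (heM v h).trans M.le_succ
          · exact le_rfl
        rw [h1]
        refine le_antisymm (Submodule.span_le.2 (hB.extend_subset hsub)) ?_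
        have := hB.subset_span_extend hsub
        simpa using this

/-- A basis adapted to a finite flag. -/
theorem exists_linearIndependent_span_image_eq (W : ℕ → Submodule k V) (hW : Monotone W)
    (h0 : W 0 = ⊥) (M : ℕ) [FiniteDimensional k (W M)] :
    ∃ (ι : Type v) (_ : Fintype ι) (b : ι → V) (e : ι → ℕ), LinearIndependent k b ∧
      (∀ i, 0 < e i ∧ e i ≤ M) ∧ ∀ s ≤ M, Submodule.span k (b '' {i | e i ≤ s}) = W s := by
  obtain ⟨B, e, hB, hBW, heM, hspan⟩ := exists_linearIndepOn_span_eq W hW h0 M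
  have hfin : Finite B := by
    have h1 : LinearIndependent k (fun v : B => (⟨v, hBW v.2⟩ : W M)) :=
      LinearIndependent.of_comp (W M).subtype hB
    exact h1.finite
  have himg : ∀ s, (fun v : B => (v : V)) '' {i | e i ≤ s} = {v ∈ B | e v ≤ s} := by
    intro s
    ext v
    simp
    tauto
  refine ⟨B, Fintype.ofFinite B, fun v => v, fun v => e v, hB, fun v => ⟨?_, heM v v.2⟩,
    fun s hs => ?_⟩
  · by_contra h
    have h1 : (v : V) ∈ Submodule.span k {v ∈ B | e v ≤ 0} :=
      Submodule.subset_span ⟨v.2, by simpa using h⟩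
    rw [hspan 0 M.zero_le, h0, Submodule.mem_bot] at h1
    exact (LinearIndependent.ne_zero v hB) h1
  · rw [himg, hspan s hs]

end Flag

/-! ### Adapted generators of the augmentation ideal. -/

section Generators

variable {k : Type u} [Field k] {p : ℕ} [Fact p.Prime] {H : Type v} [CommRing H] [Bialgebra k H]
  [CharP H p]

/-- For `z ∈ m` one has `h z ≡ ε(h) z` modulo `m²`, so ideal generators of `m` already span over
`k`. -/
theorem finiteDimensional_map_mkQ_augIdeal [IsNoetherianRing H] :
    FiniteDimensional k (((augIdeal k H).restrictScalars k).map
      ((augIdeal k H ^ 2).restrictScalars k).mkQ) := by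
  obtain ⟨S, hS⟩ := IsNoetherian.noetherian (augIdeal k H)
  have hle : ((augIdeal k H).restrictScalars k).map ((augIdeal k H ^ 2).restrictScalars k).mkQ ≤
      Submodule.span k (((augIdeal k H ^ 2).restrictScalars k).mkQ '' S) := by
    rintro _ ⟨y, hy, rfl⟩
    have hy' : y ∈ Submodule.span H (S : Set H) := hS ▸ hy
    induction hy' using Submodule.span_induction with
    | mem z hz => exact Submodule.subset_span ⟨z, hz, rfl⟩
    | zero => simp
    | add a b ha hb ha' hb' =>
      rw [map_add]
      exact Submodule.add_mem _ (ha' (hS ▸ ha)) (hb' (hS ▸ hb))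
    | smul h z hz hz' =>
      have hz1 : z ∈ augIdeal k H := hS ▸ hz
      have h1 : h • z = Coalgebra.counit (R := k) h • z +
          (h - algebraMap k H (Coalgebra.counit h)) * z := by
        rw [smul_eq_mul, Algebra.smul_def]
        ring
      have h2 : (h - algebraMap k H (Coalgebra.counit h)) * z ∈
          (augIdeal k H ^ 2).restrictScalars k := by
        rw [Submodule.restrictScalars_mem, pow_two]
        exact Ideal.mul_mem_mul (by simp) hz1
      rw [h1, map_add, map_smul, Submodule.mkQ_apply _ (_ * z),
        (Submodule.Quotient.mk_eq_zero _).2 h2, add_zero]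
      exact Submodule.smul_mem _ _ (hz' hz1)
  have := FiniteDimensional.span_of_finite k
    (S.finite_toSet.image ((augIdeal k H ^ 2).restrictScalars k).mkQ)
  exact Submodule.finiteDimensional_of_le hle

theorem ker_iterateFrobenius_mono : Monotone fun s => RingHom.ker (iterateFrobenius H p s) := by
  intro s t hst x hx
  rw [RingHom.mem_ker, iterateFrobenius_def] at hx ⊢
  exact pow_eq_zero_of_le (Nat.pow_le_pow_right (Fact.out : p.Prime).pos hst) hx

theorem ker_iterateFrobenius_le_augIdeal (s : ℕ) :
    RingHom.ker (iterateFrobenius H p s) ≤ augIdeal k H := by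
  intro x hx
  have h1 : x ^ p ^ s = 0 := hx
  have h2 := congrArg (Bialgebra.counitAlgHom k H) h1
  rw [map_pow, map_zero] at h2
  exact eq_zero_of_pow_eq_zero h2

/-- The augmentation ideal has a system of generators modulo its square which is adapted to the
kernels of the Frobenius powers. -/
theorem exists_adapted_generators [IsNoetherianRing H] (M : ℕ) :
    ∃ (ι : Type v) (_ : Fintype ι) (x : ι → H) (e : ι → ℕ), (∀ i, x i ∈ augIdeal k H) ∧
      (∀ i, 0 < e i ∧ e i ≤ M + 1) ∧ (∀ i, e i ≤ M → x i ^ p ^ e i = 0) ∧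
      (∀ y ∈ augIdeal k H, ∃ c : ι → k, y - ∑ i, c i • x i ∈ augIdeal k H ^ 2) ∧
      ∀ s ≤ M, ∀ c : ι → k, (∀ i, e i ≤ s → c i = 0) →
        ∑ i, c i • x i ∈ augIdeal k H ^ 2 ⊔ RingHom.ker (iterateFrobenius H p s) → c = 0 := by
  classical
  let q := ((augIdeal k H ^ 2).restrictScalars k).mkQ
  have hq : ∀ y, q y = 0 ↔ y ∈ augIdeal k H ^ 2 := fun y =>
    Submodule.Quotient.mk_eq_zero ((augIdeal k H ^ 2).restrictScalars k)
  -- Capping the flag by `m` makes the basis span all of `m / m²`; level `M + 1` marks the vectors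
  -- not coming from the kernel of the `M`-th Frobenius power.
  let N : ℕ → Ideal H := fun s =>
    if s ≤ M then RingHom.ker (iterateFrobenius H p s) else augIdeal k H
  have hN : Monotone N := by
    intro s t hst
    simp only [N]
    split_ifs with h1 h2
    · exact ker_iterateFrobenius_mono hst
    · exact ker_iterateFrobenius_le_augIdeal s
    · omega
    · exact le_rfl
  let W : ℕ → Submodule k _ := fun s => ((N s).restrictScalars k).map q
  have hW : Monotone W := fun s t hst => Submodule.map_mono (hN hst)
  have hW0 : W 0 = ⊥ := by
    simp only [W, N, Nat.zero_le, if_true]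
    rw [eq_bot_iff]
    rintro _ ⟨y, hy, rfl⟩
    have : y ^ p ^ 0 = 0 := hy
    rw [pow_zero, pow_one] at this
    simp [this]
  have hWM : W (M + 1) = ((augIdeal k H).restrictScalars k).map q := by
    simp only [W, N]
    rw [if_neg (by omega)]
  have : FiniteDimensional k (W (M + 1)) := by
    rw [hWM]
    exact finiteDimensional_map_mkQ_augIdeal
  obtain ⟨ι, hι, b, e, hb, he, hspan⟩ := exists_linearIndependent_span_image_eq W hW hW0 (M + 1)
  have hrep : ∀ i, ∃ y ∈ N (e i), q y = b i := by
    intro i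
    have h1 : b i ∈ W (e i) := by
      rw [← hspan (e i) (he i).2]
      exact Submodule.subset_span ⟨i, le_refl (e i), rfl⟩
    obtain ⟨y, hy, hyb⟩ := h1
    exact ⟨y, hy, hyb⟩
  choose x hx hxb using hrep
  have hNm : ∀ s, N s ≤ augIdeal k H := by
    intro s
    simp only [N]
    split_ifs
    · exact ker_iterateFrobenius_le_augIdeal s
    · exact le_rfl
  refine ⟨ι, hι, x, e, fun i => hNm _ (hx i), he, fun i hi => ?_, fun y hy => ?_,
    fun s hs c hc hmem => ?_⟩
  · have := hx i
    simp only [N, if_pos hi] at this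
    exact this
  · have h1 : q y ∈ Submodule.span k (b '' {i | e i ≤ M + 1}) := by
      rw [hspan _ le_rfl, hWM]
      exact ⟨y, hy, rfl⟩
    have h2 : q y ∈ Submodule.span k (Set.range b) :=
      Submodule.span_mono (Set.image_subset_range _ _) h1
    obtain ⟨c, hc⟩ := (Submodule.mem_span_range_iff_exists_fun k).1 h2
    refine ⟨c, (hq _).1 ?_⟩
    rw [map_sub, ← hc, map_sum, sub_eq_zero]
    simp [hxb]
  · have h1 : ∑ i, c i • b i ∈ Submodule.span k (b '' {i | e i ≤ s}) := by
      rw [hspan s (by omega)]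
      obtain ⟨y, hy, z, hz, hyz⟩ := Submodule.mem_sup.1 hmem
      refine ⟨z, by simp only [N, if_pos hs]; exact hz, ?_⟩
      have h3 := congrArg q hyz
      rw [map_add, (hq y).2 hy, zero_add, map_sum] at h3
      rw [h3]
      simp [hxb]
    have h2 : ∑ i, c i • b i ∈ Submodule.span k (b '' {i | ¬ e i ≤ s}) := by
      refine Submodule.sum_mem _ fun i _ => ?_
      by_cases hi : e i ≤ s
      · rw [hc i hi, zero_smul]
        exact Submodule.zero_mem _
      · exact Submodule.smul_mem _ _ (Submodule.subset_span ⟨i, hi, rfl⟩)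
    have h3 := Submodule.disjoint_def.1 (hb.disjoint_span_image
      (s := {i | e i ≤ s}) (t := {i | ¬ e i ≤ s})
      (Set.disjoint_left.2 fun i hi hi' => hi' hi)) _ h1 h2
    exact funext (Fintype.linearIndependent_iff.1 hb c h3)

/-- Generators of the augmentation ideal modulo its square: parameters `u` of the reduced quotient
and nilpotent elements `t`, adapted to the kernels of the Frobenius powers. -/
theorem exists_parameters [IsNoetherianRing H] :
    ∃ (M r n : ℕ) (u : Fin r → H) (t : Fin n → H) (e : Fin n → ℕ),
      (∀ y ∈ nilradical H, y ^ p ^ M = 0) ∧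
      (∀ i, Sum.elim u t i ∈ augIdeal k H) ∧
      (∀ j, 0 < e j ∧ e j ≤ M ∧ t j ^ p ^ e j = 0) ∧
      (∀ y ∈ augIdeal k H, ∃ c : Fin r ⊕ Fin n → k,
        y - ∑ i, c i • Sum.elim u t i ∈ augIdeal k H ^ 2) ∧
      (∀ M' ≥ M, IsAdapted k p (Sum.elim u t) (Sum.elim (fun _ => M') e)) ∧
      ∀ c : Fin r → k, ∑ i, c i • u i ∈ augIdeal k H ^ 2 ⊔ nilradical H → c = 0 := by
  classical
  have hp := (Fact.out : p.Prime)
  obtain ⟨M, hM⟩ : ∃ M, ∀ y ∈ nilradical H, y ^ p ^ M = 0 := by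
    obtain ⟨n, hn⟩ := IsNoetherianRing.isNilpotent_nilradical H
    refine ⟨n, fun y hy => ?_⟩
    have h1 : y ^ n ∈ nilradical H ^ n := Ideal.pow_mem_pow hy n
    rw [hn] at h1
    exact pow_eq_zero_of_le (Nat.lt_pow_self hp.one_lt).le h1
  have hker : ∀ s, RingHom.ker (iterateFrobenius H p s) ≤ nilradical H := fun s y hy =>
    mem_nilradical.2 ⟨p ^ s, hy⟩
  have hnil : nilradical H ≤ RingHom.ker (iterateFrobenius H p M) := fun y hy => hM y hy
  obtain ⟨ι, _, x, e, hx, he, hxe, hgen, hind⟩ := exists_adapted_generators (k := k) (p := p)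
    (H := H) M
  -- The generators of level `M + 1` become `u`, those of lower level become `t`. By the choice of
  -- `M`, the kernel of the `M`-th Frobenius power is the whole nilradical.
  let φ : Fin (Fintype.card {i // e i = M + 1}) ⊕ Fin (Fintype.card {i // ¬ e i = M + 1}) ≃ ι :=
    (Equiv.sumCongr (Fintype.equivFin _).symm (Fintype.equivFin _).symm).trans
      (Equiv.sumCompl fun i => e i = M + 1)
  have hφl : ∀ i, e (φ (Sum.inl i)) = M + 1 := fun i => ((Fintype.equivFin _).symm i).2
  have hφr : ∀ i, ¬ e (φ (Sum.inr i)) = M + 1 := fun i => ((Fintype.equivFin _).symm i).2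
  have hφr' : ∀ i, e (φ (Sum.inr i)) ≤ M := fun i => by
    have := hφr i
    have := (he (φ (Sum.inr i))).2
    omega
  have helim : ∀ i, Sum.elim (fun i => x (φ (Sum.inl i))) (fun i => x (φ (Sum.inr i))) i =
      x (φ i) := by
    rintro (i | i) <;> rfl
  have hsum : ∀ c : _ → k, ∑ i, c i • x (φ i) = ∑ i, c (φ.symm i) • x i := fun c =>
    Fintype.sum_equiv φ _ _ (by simp)
  have hind' : ∀ s ≤ M, ∀ c : _ → k, (∀ i, e (φ i) ≤ s → c i = 0) →
      ∑ i, c i • x (φ i) ∈ augIdeal k H ^ 2 ⊔ RingHom.ker (iterateFrobenius H p s) → c = 0 := by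
    intro s hs c hc hmem
    have h1 := hind s hs (fun i => c (φ.symm i)) (fun i hi => hc _ (by simpa using hi))
      (by rwa [← hsum])
    ext i
    simpa using congrFun h1 (φ i)
  refine ⟨M, _, _, fun i => x (φ (Sum.inl i)), fun i => x (φ (Sum.inr i)),
    fun i => e (φ (Sum.inr i)), hM, fun i => ?_, fun j => ⟨(he _).1, hφr' j, hxe _ (hφr' j)⟩,
    fun y hy => ?_, fun M' hM' s c hc hmem => ?_, fun c hmem => ?_⟩
  · rw [helim]
    exact hx _
  · obtain ⟨c, hc⟩ := hgen y hy
    refine ⟨fun i => c (φ i), ?_⟩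
    simp only [helim]
    rw [hsum fun i => c (φ i)]
    simpa using hc
  · simp only [helim] at hmem
    rcases le_total s M with hs | hs
    · refine hind' s hs c (fun i hi => ?_) hmem
      rcases i with i | i
      · rw [hφl] at hi
        omega
      · exact hc _ hi
    -- Beyond `M` the Frobenius kernels no longer grow, so level `M` decides.
    · refine hind' M le_rfl c (fun i hi => ?_)
        ((sup_le_sup le_rfl ((hker s).trans hnil)) hmem)
      rcases i with i | i
      · rw [hφl] at hi
        omega
      · exact hc _ (hi.trans hs)
  · have h1 := hind' M le_rfl (Sum.elim c 0) (fun i hi => ?_) ?_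
    · ext i
      exact congrFun h1 (Sum.inl i)
    · rcases i with i | i
      · rw [hφl] at hi
        omega
      · rfl
    · rw [Fintype.sum_sum_type]
      simpa using (sup_le_sup le_rfl hnil) hmem

end Generators

/-! ### The comparison map and translation by the quotient Hopf algebra. -/

section Translation

open Algebra.TensorProduct

variable {k : Type u} [Field k] {H : Type v} [CommRing H] [Bialgebra k H] {K : Type w} [CommRing K]
  [HopfAlgebra k K] (π : H →ₐc[k] K)

/-- The coaction `h ↦ h₍₁₎ ⊗ π (h₍₂₎)`. -/
noncomputable abbrev rcoact : H →ₐ[k] H ⊗[k] K := (ComoduleAlgebra.ofBialgHom π).coact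

/-- The map `x ⊗ y ↦ x S(y)`. -/
noncomputable def mulAntipode (k : Type u) [Field k] (K : Type w) [CommRing K] [HopfAlgebra k K] :
    K ⊗[k] K →ₐ[k] K :=
  productMap (AlgHom.id k K) (HopfAlgebra.antipodeAlgHom k K)

theorem mulAntipode_comp_comul : (mulAntipode k K).comp (Bialgebra.comulAlgHom k K) =
    (Algebra.ofId k K).comp (Bialgebra.counitAlgHom k K) := by
  have key : ∀ t : K ⊗[k] K, mulAntipode k K t =
      LinearMap.mul' k K ((HopfAlgebraStruct.antipode k).lTensor K t) := by
    intro t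
    induction t with
    | zero => simp
    | add a b ha hb => simp only [map_add, ha, hb]
    | tmul a b => simp [mulAntipode]
  ext a
  exact (key _).trans (HopfAlgebra.mul_antipode_lTensor_comul_apply a)

theorem map_counit_rcoact (h : H) :
    map ((Algebra.ofId k H).comp (Bialgebra.counitAlgHom k H)) (AlgHom.id k K) (rcoact π h) =
      1 ⊗ₜ π h := by
  have key : ∀ t : H ⊗[k] H, map ((Algebra.ofId k H).comp (Bialgebra.counitAlgHom k H))
      (AlgHom.id k K) (map (AlgHom.id k H) (π : H →ₐ[k] K) t) =
      1 ⊗ₜ π (TensorProduct.lid k H (Coalgebra.counit.rTensor H t)) := by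
    intro t
    induction t with
    | zero => simp
    | add a b ha hb => simp only [map_add, ha, hb, TensorProduct.tmul_add]
    | tmul a b =>
      simp [Algebra.ofId_apply, Algebra.algebraMap_eq_smul_one, TensorProduct.smul_tmul]
  refine (key _).trans ?_
  simp

theorem map_rcoact (h : H) :
    map (π : H →ₐ[k] K) (AlgHom.id k K) (rcoact π h) = Coalgebra.comul (π h) := by
  have h1 := CoalgHomClass.map_comp_comul_apply π h
  rw [← h1]
  have key : ∀ t : H ⊗[k] H, map (π : H →ₐ[k] K) (AlgHom.id k K)
      (map (AlgHom.id k H) (π : H →ₐ[k] K) t) = TensorProduct.map (π : H →ₗ[k] K) (π : H →ₗ[k] K) t := by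
    intro t
    induction t with
    | zero => simp
    | add a b ha hb => simp only [map_add, ha, hb]
    | tmul a b => simp
  exact key _

/-- The map `h ⊗ x ↦ h₍₁₎ ⊗ π (h₍₂₎) S(x)`. -/
noncomputable def untranslate : H ⊗[k] K →ₐ[k] H ⊗[k] K :=
  productMap (rcoact π) (includeRight.comp (HopfAlgebra.antipodeAlgHom k K))

theorem untranslate_tmul_one (h : H) : untranslate π (h ⊗ₜ 1) = rcoact π h := by
  rw [untranslate, productMap_apply_tmul, map_one, mul_one]

/-- By the antipode axiom, `h₍₁₎ ⊗ π (h₍₂₎) S(π (h₍₃₎))` collapses. Thus `untranslate` exchanges `h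
⊗ 1` and the coaction of `h`. -/
theorem untranslate_rcoact (h : H) : untranslate π (rcoact π h) = h ⊗ₜ 1 := by
  have key : ∀ t : H ⊗[k] K, untranslate π t =
      map (AlgHom.id k H) (mulAntipode k K) (Algebra.TensorProduct.assoc k k k H K K
        (map (rcoact π) (AlgHom.id k K) t)) := by
    intro t
    induction t with
    | zero => simp
    | add a b ha hb => simp only [map_add, ha, hb]
    | tmul a b =>
      simp only [untranslate, productMap_apply_tmul, map_tmul, AlgHom.comp_apply, AlgHom.id_apply]
      generalize rcoact π a = s
      induction s with
      | zero => simp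
      | add c d hc hd => simp only [add_mul, TensorProduct.add_tmul, map_add, hc, hd]
      | tmul c d => simp [mulAntipode]
  have h1 := AlgHom.congr_fun (ComoduleAlgebra.ofBialgHom π).coassoc h
  have h2 := AlgHom.congr_fun (ComoduleAlgebra.ofBialgHom π).counital h
  rw [key]
  refine (congrArg (map (AlgHom.id k H) (mulAntipode k K)) h1).trans ?_
  rw [AlgHom.comp_apply, ← AlgHom.comp_apply, ← map_comp, mulAntipode_comp_comul, AlgHom.id_comp,
    ← AlgHom.id_comp (AlgHom.id k H), map_comp, AlgHom.comp_apply]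
  refine (congrArg (map (AlgHom.id k H) (Algebra.ofId k K)) h2).trans ?_
  simp

theorem mulAntipode_map_rcoact (h : H) :
    mulAntipode k K (map (π : H →ₐ[k] K) (AlgHom.id k K) (rcoact π h)) =
      algebraMap k K (Coalgebra.counit h) := by
  rw [map_rcoact]
  refine (AlgHom.congr_fun mulAntipode_comp_comul (π h)).trans ?_
  exact congrArg (algebraMap k K) (CoalgHomClass.counit_comp_apply π h)

section Comparison

variable {B : Type w'} [CommRing B] [Algebra k B] (f : H →ₐ[k] B)

/-- The map `h ↦ f (h₍₁₎) ⊗ π (h₍₂₎)`. -/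
noncomputable def comparison : H →ₐ[k] B ⊗[k] K := (map f (AlgHom.id k K)).comp (rcoact π)

/-- Coassociativity suffices, because `f` touches only the first tensor factor. -/
theorem comparison_colinear (h : H) :
    (ComoduleAlgebra.tensor (k := k) (K := K) B).coact (comparison π f h) =
      map (comparison π f) (AlgHom.id k K) (rcoact π h) := by
  have key1 : ∀ t : H ⊗[k] K, (ComoduleAlgebra.tensor (k := k) (K := K) B).coact
      (map f (AlgHom.id k K) t) = (Algebra.TensorProduct.assoc k k k B K K).symm
        (map f (AlgHom.id k (K ⊗[k] K)) (map (AlgHom.id k H) (Bialgebra.comulAlgHom k K) t)) := by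
    intro t
    induction t with
    | zero => simp
    | add a b ha hb => simp only [map_add, ha, hb]
    | tmul a b => simp [ComoduleAlgebra.tensor]
  have key2 : ∀ t : H ⊗[k] K, map (comparison π f) (AlgHom.id k K) t =
      (Algebra.TensorProduct.assoc k k k B K K).symm (map f (AlgHom.id k (K ⊗[k] K))
        (Algebra.TensorProduct.assoc k k k H K K (map (rcoact π) (AlgHom.id k K) t))) := by
    intro t
    induction t with
    | zero => simp
    | add a b ha hb => simp only [map_add, ha, hb]
    | tmul a b =>
      simp only [comparison, map_tmul, AlgHom.comp_apply, AlgHom.id_apply]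
      generalize rcoact π a = s
      induction s with
      | zero => simp
      | add c d hc hd => simp only [TensorProduct.add_tmul, map_add, hc, hd]
      | tmul c d => simp
  have h1 := AlgHom.congr_fun (ComoduleAlgebra.ofBialgHom π).coassoc h
  rw [key2]
  refine (key1 _).trans ?_
  exact congrArg (fun y => (Algebra.TensorProduct.assoc k k k B K K).symm
    (map f (AlgHom.id k (K ⊗[k] K)) y)) h1.symm

variable {π f}

/-- As `π` is a coalgebra map, the coaction sends `ker π` into `ker π ⊗ K`. Applying `untranslate`
and then `f ⊗ id` turns the coaction of `t` into `f t ⊗ 1` and each `h ⊗ 1` into `comparison π f h`.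
-/
theorem tmul_one_mem_map_comparison (hπ : Function.Surjective π) {t : H}
    (ht : t ∈ RingHom.ker (π : H →ₐ[k] K)) :
    f t ⊗ₜ[k] (1 : K) ∈ (RingHom.ker (π : H →ₐ[k] K)).map (comparison π f) := by
  have h1 : rcoact π t ∈
      (RingHom.ker (π : H →ₐ[k] K)).map (includeLeft : H →ₐ[k] H ⊗[k] K) := by
    rw [← rTensor_ker (π : H →ₐ[k] K) hπ, RingHom.mem_ker]
    refine (map_rcoact π t).trans ?_
    have : π t = 0 := ht
    rw [this, map_zero]
  have h2 : f t ⊗ₜ[k] (1 : K) =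
      ((map f (AlgHom.id k K)).comp (untranslate π)) (rcoact π t) := by
    rw [AlgHom.comp_apply, untranslate_rcoact]
    simp
  rw [h2]
  have h3 := Ideal.mem_map_of_mem ((map f (AlgHom.id k K)).comp (untranslate π)) h1
  rw [Ideal.map_mapₐ] at h3
  convert h3 using 2
  ext h
  simp [untranslate_tmul_one, comparison]

theorem tmul_mem_map_comparison (hπ : Function.Surjective π) {b : B}
    (hb : b ∈ (RingHom.ker (π : H →ₐ[k] K)).map f) (y : K) :
    b ⊗ₜ[k] y ∈ (RingHom.ker (π : H →ₐ[k] K)).map (comparison π f) := by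
  have hle : (RingHom.ker (π : H →ₐ[k] K)).map f ≤
      ((RingHom.ker (π : H →ₐ[k] K)).map (comparison π f)).comap
        (includeLeft : B →ₐ[k] B ⊗[k] K) :=
    Ideal.map_le_iff_le_comap.2 fun t ht => tmul_one_mem_map_comparison hπ ht
  have h1 : b ⊗ₜ[k] (1 : K) ∈ (RingHom.ker (π : H →ₐ[k] K)).map (comparison π f) := hle hb
  have h2 := Ideal.mul_mem_right (1 ⊗ₜ y) _ h1
  rwa [tmul_mul_tmul, mul_one, one_mul] at h2

/-- Modulo this ideal `f` may be replaced by the counit, and `ε(h₍₁₎) π (h₍₂₎) = π h`. -/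
theorem comparison_sub_mem (hπ : Function.Surjective π)
    (hf : ∀ h, f h - algebraMap k B (Coalgebra.counit h) ∈ (RingHom.ker (π : H →ₐ[k] K)).map f)
    (h : H) :
    comparison π f h - 1 ⊗ₜ π h ∈ (RingHom.ker (π : H →ₐ[k] K)).map (comparison π f) := by
  have key : ∀ t : H ⊗[k] K, map f (AlgHom.id k K) t - map f (AlgHom.id k K)
      (map ((Algebra.ofId k H).comp (Bialgebra.counitAlgHom k H)) (AlgHom.id k K) t) ∈
      (RingHom.ker (π : H →ₐ[k] K)).map (comparison π f) := by
    intro t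
    induction t with
    | zero => simp
    | add a b ha hb =>
      simp only [map_add]
      rw [add_sub_add_comm]
      exact Ideal.add_mem _ ha hb
    | tmul a b =>
      have h1 := tmul_mem_map_comparison hπ (hf a) b
      rw [TensorProduct.sub_tmul] at h1
      simpa [Algebra.ofId_apply] using h1
  have := key (rcoact π h)
  rw [map_counit_rcoact, map_tmul, map_one] at this
  exact this

/-- Modulo the extension of `ker π` every element comes from some `π h`, hence is in the image. The
error is then pushed through successive powers of the nilpotent ideal `ker π`. -/
theorem comparison_surjective (hπ : Function.Surjective π)
    (hnil : IsNilpotent (RingHom.ker (π : H →ₐ[k] K))) (hfs : Function.Surjective f)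
    (hf : ∀ h, f h - algebraMap k B (Coalgebra.counit h) ∈ (RingHom.ker (π : H →ₐ[k] K)).map f) :
    Function.Surjective (comparison π f) := by
  set I := RingHom.ker (π : H →ₐ[k] K) with hI
  have h1 : ∀ z : B ⊗[k] K, ∃ h, z - comparison π f h ∈ I.map (comparison π f) := by
    intro z
    induction z with
    | zero => exact ⟨0, by simp⟩
    | add a b ha hb =>
      obtain ⟨x, hx⟩ := ha
      obtain ⟨y, hy⟩ := hb
      refine ⟨x + y, ?_⟩
      rw [map_add, add_sub_add_comm]
      exact Ideal.add_mem _ hx hy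
    | tmul b y =>
      obtain ⟨b, rfl⟩ := hfs b
      obtain ⟨y, rfl⟩ := hπ y
      have h2 := tmul_mem_map_comparison hπ (hf b) (π y)
      rw [TensorProduct.sub_tmul] at h2
      have h3 := comparison_sub_mem hπ hf (Coalgebra.counit (R := k) b • y)
      refine ⟨Coalgebra.counit (R := k) b • y, ?_⟩
      have h4 := Ideal.sub_mem _ h2 h3
      convert h4 using 1
      rw [map_smul π, TensorProduct.tmul_smul,
        Algebra.algebraMap_eq_smul_one, ← TensorProduct.smul_tmul']
      ring
  have h2 : ∀ n, ∀ z ∈ (I ^ n).map (comparison π f), ∀ w, ∃ h,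
      w * z - comparison π f h ∈ (I ^ (n + 1)).map (comparison π f) := by
    intro n z hz
    induction hz using Submodule.span_induction with
    | mem z hz =>
      obtain ⟨y, hy, rfl⟩ := hz
      intro w
      obtain ⟨h, hh⟩ := h1 w
      refine ⟨h * y, ?_⟩
      have : w * comparison π f y - comparison π f (h * y) =
          (w - comparison π f h) * comparison π f y := by
        rw [map_mul]
        ring
      rw [pow_succ', Ideal.map_mul]
      exact this ▸ Ideal.mul_mem_mul hh (Ideal.mem_map_of_mem _ hy)
    | zero => exact fun w => ⟨0, by simp⟩
    | add a b _ _ ha hb =>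
      intro w
      obtain ⟨x, hx⟩ := ha w
      obtain ⟨y, hy⟩ := hb w
      refine ⟨x + y, ?_⟩
      rw [map_add, mul_add, add_sub_add_comm]
      exact Ideal.add_mem _ hx hy
    | smul c z _ hz =>
      intro w
      obtain ⟨x, hx⟩ := hz (w * c)
      exact ⟨x, by rwa [smul_eq_mul, ← mul_assoc]⟩
  have h3 : ∀ n, ∀ z, ∃ h, z - comparison π f h ∈ (I ^ n).map (comparison π f) := by
    intro n
    induction n with
    | zero => exact fun z => ⟨0, by simp [Ideal.map_top]⟩
    | succ n ih =>
      intro z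
      obtain ⟨h, hh⟩ := ih z
      obtain ⟨h', hh'⟩ := h2 n _ hh 1
      refine ⟨h + h', ?_⟩
      rwa [map_add, ← sub_sub, ← one_mul (z - comparison π f h)]
  obtain ⟨n, hn⟩ := hnil
  intro z
  obtain ⟨h, hh⟩ := h3 n z
  rw [hn, Ideal.zero_eq_bot, Ideal.map_bot, Ideal.mem_bot, sub_eq_zero] at hh
  exact ⟨h, hh.symm⟩

/-- A comparison map which is injective near the counit is injective. -/
theorem comparison_injective (hπ : Function.Surjective π)
    (hnil : IsNilpotent (RingHom.ker (π : H →ₐ[k] K)))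
    (hs : Function.Surjective (comparison π f)) (c : H) (hc : Coalgebra.counit (R := k) c = 1)
    (hcL : ∀ l, comparison π f l = 0 → c * l = 0) : Function.Injective (comparison π f) := by
  rw [injective_iff_map_eq_zero]
  -- By colinearity the kernel is a subcomodule, so `untranslate` writes `l ⊗ 1` in the ideal
  -- generated by coactions of kernel elements `y`; the coaction of `c` kills these since `c y = 0`.
  have h1 : ∀ l, comparison π f l = 0 → rcoact π c * (l ⊗ₜ 1) = 0 := by
    intro l hl
    have h2 : rcoact π l ∈
        (RingHom.ker (comparison π f)).map (includeLeft : H →ₐ[k] H ⊗[k] K) := by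
      rw [← rTensor_ker (comparison π f) hs, RingHom.mem_ker]
      refine (comparison_colinear π f l).symm.trans ?_
      rw [hl, map_zero]
    rw [← untranslate_rcoact π l]
    generalize rcoact π l = w at h2
    induction h2 using Submodule.span_induction with
    | mem z hz =>
      obtain ⟨y, hy, rfl⟩ := hz
      refine (congrArg (rcoact π c * ·) (untranslate_tmul_one π y)).trans ?_
      rw [← map_mul, hcL y hy, map_zero]
    | zero => simp
    | add a b _ _ ha hb => rw [map_add, mul_add, ha, hb, add_zero]
    | smul b z _ hz => rw [smul_eq_mul, map_mul, mul_left_comm, hz, mul_zero]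
  let e := Module.Basis.ofVectorSpace k K
  obtain ⟨d, hd⟩ := TensorProduct.eq_repr_basis_right e (rcoact π c)
  have h2 : ∀ l, comparison π f l = 0 → ∀ i, d i * l = 0 := by
    intro l hl
    have h3 := h1 l hl
    rw [← hd, Finsupp.sum, Finset.sum_mul] at h3
    simp only [tmul_mul_tmul, mul_one] at h3
    intro i
    by_cases hi : i ∈ d.support
    · have h4 := congrArg (fun y => TensorProduct.rid k H ((e.coord i).lTensor H y)) h3
      simp only [map_sum, LinearMap.lTensor_tmul, TensorProduct.rid_tmul, map_zero,
        Module.Basis.coord_apply, Module.Basis.repr_self] at h4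
      rw [Finset.sum_eq_single i] at h4
      · simpa using h4
      · intro j _ hj
        rw [Finsupp.single_eq_of_ne hj.symm, zero_smul]
      · exact fun h => absurd hi h
    · rw [Finsupp.notMem_support_iff.1 hi, zero_mul]
  choose s hs using fun i => hπ (HopfAlgebra.antipodeAlgHom k K (e i))
  -- The antipode axiom gives `π a = ε(c) = 1`, so `a` is a unit modulo a nilpotent ideal, hence a
  -- unit, while each `d i` kills the kernel.
  set a := ∑ i ∈ d.support, d i * s i with ha
  have h3 : π a = 1 := by
    have h4 := mulAntipode_map_rcoact π c
    rw [← hd, hc, map_one, Finsupp.sum, map_sum, map_sum] at h4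
    rw [← h4, ha, map_sum]
    refine Finset.sum_congr rfl fun i _ => ?_
    rw [map_mul, hs]
    simp [mulAntipode]
  have h4 : IsUnit a := by
    have h5 : IsNilpotent (1 - a) := by
      obtain ⟨n, hn⟩ := hnil
      refine ⟨n, ?_⟩
      have : 1 - a ∈ RingHom.ker (π : H →ₐ[k] K) := by
        have : π (1 - a) = 0 := by rw [map_sub, h3, map_one, sub_self]
        exact this
      have := Ideal.pow_mem_pow this n
      rwa [hn] at this
    simpa using h5.isUnit_one_sub
  intro l hl
  rw [← h4.mul_right_eq_zero, ha, Finset.sum_mul]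
  refine Finset.sum_eq_zero fun i _ => ?_
  rw [mul_right_comm, h2 l hl, zero_mul]

end Comparison

end Translation

/-! ### Dimension counts from finite families. -/

section Dimension

variable {k : Type u} [Field k]

theorem card_le_finrank_of_forall_coeff_eq_zero {V : Type v} [AddCommGroup V] [Module k V]
    [Module.Finite k V] {α : Type*} (s : Finset α) (y : α → V)
    (h : ∀ c : α → k, ∑ a ∈ s, c a • y a = 0 → ∀ a ∈ s, c a = 0) :
    s.card ≤ Module.finrank k V := by
  have hli : LinearIndepOn k y (s : Set α) := by
    rw [linearIndepOn_finset_iff]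
    exact h
  have := LinearIndependent.fintype_card_le_finrank hli
  simpa using this

theorem finite_and_finrank_le_card {V : Type v} [AddCommGroup V] [Module k V] {α : Type*}
    (s : Finset α) (y : α → V) (h : ∀ v, ∃ c : α → k, v = ∑ a ∈ s, c a • y a) :
    Module.Finite k V ∧ Module.finrank k V ≤ s.card := by
  classical
  have hspan : Submodule.span k ((s.image y : Finset V) : Set V) = ⊤ := by
    rw [eq_top_iff]
    intro v _
    obtain ⟨c, rfl⟩ := h v
    exact Submodule.sum_mem _ fun a ha => Submodule.smul_mem _ _
      (Submodule.subset_span (by exact_mod_cast Finset.mem_image_of_mem y ha))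
  refine ⟨⟨⟨s.image y, hspan⟩⟩, ?_⟩
  rw [← finrank_top k V, ← hspan]
  exact (finrank_span_finset_le_card _).trans Finset.card_image_le

theorem card_box_sum {ι κ : Type*} [Fintype ι] [Fintype κ] [DecidableEq ι] [DecidableEq κ] (p : ℕ)
    (e : ι → ℕ) (e' : κ → ℕ) :
    (box p (Sum.elim e e')).card = (box p e).card * (box p e').card := by
  simp [box, Fintype.card_piFinset, Fintype.prod_sum_type]

end Dimension

/-! ### Monomials in the truncated polynomial algebra. -/

section TruncPoly

variable {k : Type u} [Field k] {p n : ℕ}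

/-- The generators of the truncated polynomial algebra. -/
noncomputable def TruncPoly.gen (k : Type u) [Field k] (p : ℕ) {n : ℕ} (e : Fin n → ℕ)
    (i : Fin n) : TruncPoly k p e :=
  Ideal.Quotient.mkₐ k _ (MvPolynomial.X i)

theorem TruncPoly.gen_pow (e : Fin n → ℕ) (i : Fin n) : TruncPoly.gen k p e i ^ p ^ e i = 0 := by
  rw [TruncPoly.gen, ← map_pow]
  exact Ideal.Quotient.eq_zero_iff_mem.2 (Ideal.subset_span ⟨i, rfl⟩)

theorem TruncPoly.aeval_gen (e : Fin n → ℕ) (P : MvPolynomial (Fin n) k) :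
    MvPolynomial.aeval (TruncPoly.gen k p e) P = Ideal.Quotient.mkₐ k _ P := by
  have : MvPolynomial.aeval (TruncPoly.gen k p e) = Ideal.Quotient.mkₐ k _ :=
    MvPolynomial.algHom_ext fun i => by rw [MvPolynomial.aeval_X]; rfl
  rw [this]

/-- The relations form a monomial ideal, and no monomial with exponents in the box is divisible by
one of its generators. -/
theorem TruncPoly.coeff_eq_zero (e : Fin n → ℕ) (c : (Fin n → ℕ) → k)
    (hc : ∑ a ∈ box p e, c a • ∏ i, TruncPoly.gen k p e i ^ a i = 0) :
    ∀ a ∈ box p e, c a = 0 := by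
  classical
  set P : MvPolynomial (Fin n) k := ∑ a ∈ box p e,
    MvPolynomial.monomial (Finsupp.equivFunOnFinite.symm a) (c a) with hP
  have hcoeff : ∀ a ∈ box p e, P.coeff (Finsupp.equivFunOnFinite.symm a) = c a := by
    intro a ha
    rw [hP, MvPolynomial.coeff_sum]
    simp only [MvPolynomial.coeff_monomial, Equiv.apply_eq_iff_eq]
    rw [Finset.sum_ite_eq', if_pos ha]
  have h1 : Ideal.Quotient.mkₐ k (Ideal.span (Set.range fun i : Fin n =>
      (MvPolynomial.X i : MvPolynomial (Fin n) k) ^ p ^ e i)) P = 0 := by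
    rw [← TruncPoly.aeval_gen, aeval_eq_sum_box (TruncPoly.gen_pow e), ← hc]
    exact Finset.sum_congr rfl fun a ha => by rw [hcoeff a ha]
  have h2 : P ∈ Ideal.span ((fun s => MvPolynomial.monomial s (1 : k)) ''
      Set.range fun i : Fin n => Finsupp.single i (p ^ e i)) := by
    have h3 : (fun s => MvPolynomial.monomial s (1 : k)) ∘
        (fun i : Fin n => Finsupp.single i (p ^ e i)) =
        fun i => (MvPolynomial.X i : MvPolynomial (Fin n) k) ^ p ^ e i :=
      funext fun i => MvPolynomial.X_pow_eq_monomial.symm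
    rw [← Set.range_comp, h3]
    exact Ideal.Quotient.eq_zero_iff_mem.1 h1
  rw [MvPolynomial.mem_ideal_span_monomial_image] at h2
  intro a ha
  by_contra hne
  rw [← hcoeff a ha, ← ne_eq, ← MvPolynomial.mem_support_iff] at hne
  obtain ⟨_, ⟨i, rfl⟩, hi⟩ := h2 _ hne
  have h3 := mem_box.1 ha i
  rw [Finsupp.single_le_iff] at hi
  exact absurd hi (not_le.2 h3)

theorem TruncPoly.isReduced_of_zero (e : Fin 0 → ℕ) : IsReduced (TruncPoly k p e) := by
  refine ⟨fun y ⟨m, hm⟩ => ?_⟩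
  obtain ⟨P, rfl⟩ := Ideal.Quotient.mkₐ_surjective k _ y
  have hspan : Ideal.span (Set.range fun i : Fin 0 =>
      (MvPolynomial.X i : MvPolynomial (Fin 0) k) ^ p ^ e i) = ⊥ := by
    rw [Set.range_eq_empty, Ideal.span_empty]
  rw [← map_pow] at hm
  have h1 := Ideal.Quotient.eq_zero_iff_mem.1 hm
  rw [hspan, Ideal.mem_bot] at h1
  rw [eq_zero_of_pow_eq_zero h1, map_zero]

end TruncPoly

/-! ### The map onto the truncated polynomial algebra. -/

section TruncationHom

variable {k : Type u} [Field k] {p : ℕ} [Fact p.Prime]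
  {H : Type v} [CommRing H] [Bialgebra k H] [CharP H p]

theorem augFrobPow_le_augIdeal_pow (M : ℕ) : augFrobPow k p H M ≤ augIdeal k H ^ M := by
  refine Ideal.map_le_iff_le_comap.2 fun x hx => ?_
  rw [Ideal.mem_comap, iterateFrobenius_def]
  exact Ideal.pow_le_pow_right (Nat.lt_pow_self (Fact.out : p.Prime).one_lt).le
    (Ideal.pow_mem_pow hx _)

theorem augFrobPow_le_augIdeal (M : ℕ) : augFrobPow k p H M ≤ augIdeal k H :=
  Ideal.map_le_iff_le_comap.2 fun _ hx =>
    Ideal.pow_mem_of_mem _ hx _ (Nat.pow_pos (Fact.out : p.Prime).pos)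

theorem augFrobPow_antitone : Antitone (augFrobPow k p H) := by
  intro M M' h
  refine Ideal.map_le_iff_le_comap.2 fun x hx => ?_
  obtain ⟨d, rfl⟩ := Nat.exists_eq_add_of_le h
  rw [Ideal.mem_comap, iterateFrobenius_def, pow_add, pow_mul]
  exact Ideal.pow_mem_of_mem _ (Ideal.mem_map_of_mem (iterateFrobenius H p M) hx) _
    (Nat.pow_pos (Fact.out : p.Prime).pos)

/-- Killing the parameters `u` of the reduced quotient gives an algebra map onto a truncated
polynomial algebra. -/
theorem exists_truncation_hom [CharP k p] [PerfectField k] [Algebra.FiniteType k H] {M r n : ℕ}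
    (u : Fin r → H) (t : Fin n → H) (e : Fin n → ℕ)
    (hx : ∀ i, Sum.elim u t i ∈ augIdeal k H) (ht : ∀ j, e j ≤ M ∧ t j ^ p ^ e j = 0)
    (hgen : ∀ y ∈ augIdeal k H, ∃ c : Fin r ⊕ Fin n → k,
        y - ∑ i, c i • Sum.elim u t i ∈ augIdeal k H ^ 2)
    (hA : IsAdapted k p (Sum.elim u t) (Sum.elim (fun _ => M) e)) :
    ∃ f : H →ₐ[k] TruncPoly k p e, Function.Surjective f ∧ (∀ j ∈ augFrobPow k p H M, f j = 0) ∧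
      ∀ h, f h - algebraMap k _ (Coalgebra.counit h) ∈ (nilradical H).map f := by
  have hnoeth : IsNoetherianRing H := Algebra.FiniteType.isNoetherianRing k H
  have hp := (Fact.out : p.Prime)
  set J := augFrobPow k p H M with hJ
  set x := Sum.elim u t with hxdef
  set E : Fin r ⊕ Fin n → ℕ := Sum.elim (fun _ => M) e with hE
  let q : H →ₐ[k] H ⧸ J := Ideal.Quotient.mkₐ k J
  have hq0 : ∀ y, q y = 0 ↔ y ∈ J := fun y => Ideal.Quotient.eq_zero_iff_mem
  have hxJ : ∀ i, x i ^ p ^ E i ∈ J := by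
    rintro (i | i)
    · exact Ideal.mem_map_of_mem (iterateFrobenius H p M) (hx (Sum.inl i))
    · have : x (Sum.inr i) ^ p ^ E (Sum.inr i) = 0 := (ht i).2
      rw [this]
      exact J.zero_mem
  have hEM : ∀ i, E i ≤ M := by
    rintro (i | i)
    · exact le_rfl
    · exact (ht i).1
  let φ : MvPolynomial (Fin r ⊕ Fin n) k →ₐ[k] H ⧸ J := MvPolynomial.aeval fun i => q (x i)
  have hqx : ∀ i, q (x i) ^ p ^ E i = 0 := fun i => by
    rw [← map_pow, hq0]
    exact hxJ i
  have hφ : Function.Surjective φ := by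
    intro y
    obtain ⟨h, rfl⟩ := Ideal.Quotient.mkₐ_surjective k J y
    obtain ⟨c, hc⟩ := exists_sub_sum_box_mem (p := p) x hx hgen J
      (augIdeal_le_radical_augFrobPow M) E hxJ h
    refine ⟨∑ a ∈ box p E, c a • ∏ i, MvPolynomial.X i ^ a i, ?_⟩
    have h1 := (hq0 _).2 hc
    rw [map_sub, sub_eq_zero] at h1
    refine Eq.trans ?_ h1.symm
    simp [φ]
  let g : MvPolynomial (Fin r ⊕ Fin n) k →ₐ[k] TruncPoly k p e :=
    MvPolynomial.aeval (Sum.elim (0 : Fin r → _) (TruncPoly.gen k p e))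
  -- Independence modulo `J` forces the box coefficients of `P` to vanish, and these alone determine
  -- `g P`.
  have hker : RingHom.ker φ.toRingHom ≤ RingHom.ker g.toRingHom := by
    intro P hP
    have h1 : φ P = 0 := hP
    have h2 := aeval_eq_sum_box hqx P
    have h3 := coeff_eq_zero_of_sum_box_mem_augFrobPow x hx hgen M E hEM hxJ hA
      (fun a => P.coeff (Finsupp.equivFunOnFinite.symm a)) (by
        rw [← hJ, ← hq0, ← h1]
        refine Eq.trans ?_ h2.symm
        simp)
    change g P = 0
    refine (aeval_eq_sum_box (p := p) (e := E) ?_ P).trans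
      (Finset.sum_eq_zero fun a ha => by rw [h3 a ha, zero_smul])
    rintro (i | i)
    · exact zero_pow (pow_ne_zero _ hp.ne_zero)
    · exact TruncPoly.gen_pow e i
  have hg : Function.Surjective g := by
    intro y
    obtain ⟨P, rfl⟩ := Ideal.Quotient.mkₐ_surjective k _ y
    refine ⟨MvPolynomial.rename Sum.inr P, ?_⟩
    rw [← TruncPoly.aeval_gen]
    simp only [g, MvPolynomial.aeval_rename]
    rfl
  let f₀ := AlgHom.liftOfSurjective φ hφ g hker
  have hf₀ : ∀ P, f₀ (φ P) = g P := AlgHom.liftOfSurjective_apply φ hφ g hker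
  let f : H →ₐ[k] TruncPoly k p e := f₀.comp q
  have hfx : ∀ i, f (x i) = Sum.elim (0 : Fin r → _) (TruncPoly.gen k p e) i := by
    intro i
    have h1 := hf₀ (MvPolynomial.X i)
    simp only [φ, g, MvPolynomial.aeval_X] at h1
    exact h1
  have hfJ : ∀ j ∈ J, f j = 0 := by
    intro j hj
    have : q j = 0 := (hq0 j).2 hj
    simp [f, this]
  refine ⟨f, ?_, hfJ, fun h => ?_⟩
  · exact (AlgHom.liftOfSurjective_surjective φ hφ g hker hg).comp
      (Ideal.Quotient.mkₐ_surjective k J)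
  -- Modulo the image of the nilradical, `f` and the counit agree on `u`, killed by both, and on the
  -- nilpotents `t`; polynomials in these fill `H` up to `J`.
  · let c := Ideal.Quotient.mkₐ k ((nilradical H).map f)
    have h1 : (c.comp f).comp (MvPolynomial.aeval x) =
        (((Algebra.ofId k _).comp (Bialgebra.counitAlgHom k H)).comp (MvPolynomial.aeval x)) := by
      refine MvPolynomial.algHom_ext fun i => ?_
      have h2 : Bialgebra.counitAlgHom k H (x i) = 0 := hx i
      simp only [AlgHom.comp_apply, MvPolynomial.aeval_X, h2, map_zero]
      refine Ideal.Quotient.eq_zero_iff_mem.2 ?_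
      rcases i with i | i
      · rw [hfx]
        exact Ideal.zero_mem _
      · exact Ideal.mem_map_of_mem f (mem_nilradical.2 ⟨_, (ht i).2⟩)
    obtain ⟨P, hP⟩ := hφ (q h)
    have h2 : h - MvPolynomial.aeval x P ∈ J := by
      rw [← hq0, map_sub, sub_eq_zero, ← hP]
      exact (MvPolynomial.comp_aeval_apply x q P).symm
    have h3 : f h = f (MvPolynomial.aeval x P) := by
      rw [← sub_eq_zero, ← map_sub]
      exact hfJ _ h2
    have h4 : Coalgebra.counit (R := k) h = Coalgebra.counit (MvPolynomial.aeval x P) := by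
      rw [← sub_eq_zero, ← map_sub]
      exact augFrobPow_le_augIdeal M h2
    rw [h3, h4]
    refine Ideal.Quotient.eq_zero_iff_mem.1 (?_ : c _ = 0)
    rw [map_sub, sub_eq_zero, AlgHom.commutes]
    exact AlgHom.congr_fun h1 P

end TruncationHom

/-! ### Bounding the kernel of the comparison map. -/

section Kernel

open Algebra.TensorProduct

variable {k : Type u} [Field k] {p : ℕ} [Fact p.Prime] [CharP k p] {H : Type v} [CommRing H]
  [Bialgebra k H] [CharP H p] {K : Type w} [CommRing K] [HopfAlgebra k K]
  {π : H →ₐc[k] K} {B : Type w'} [CommRing B] [Algebra k B] {f : H →ₐ[k] B}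

/-- The coaction of `x` differs from `1 ⊗ π x` by an element of `m ⊗ K`, whose `p ^ M`-th power lies
in `J_M ⊗ K` and is killed by `f`. -/
theorem comparison_pow_eq {M : ℕ} (hfJ : ∀ j ∈ augFrobPow k p H M, f j = 0) (x : H) :
    comparison π f x ^ p ^ M = 1 ⊗ₜ (π x ^ p ^ M) := by
  have : Nontrivial (H ⊗[k] K) := nontrivial_of_bialgebra k (H ⊗[k] K)
  have : CharP (H ⊗[k] K) p := charP_of_nontrivial_algebra k p _
  have h1 : rcoact π x - 1 ⊗ₜ π x ∈
      (augIdeal k H).map (includeLeft : H →ₐ[k] H ⊗[k] K) := by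
    rw [← rTensor_ker (Bialgebra.counitAlgHom k H)
      (fun c => ⟨algebraMap k H c, by simp⟩), RingHom.mem_ker, map_sub, sub_eq_zero,
      ← map_counit_rcoact, ← AlgHom.comp_apply (map _ _) (map _ _), ← map_comp]
    congr 2
    ext y
    simp [Algebra.ofId_apply]
  have h2 : (augIdeal k H).map (includeLeft : H →ₐ[k] H ⊗[k] K) ≤
      ((augFrobPow k p H M).map (includeLeft : H →ₐ[k] H ⊗[k] K)).comap
        (iterateFrobenius (H ⊗[k] K) p M) := by
    refine Ideal.map_le_iff_le_comap.2 fun y hy => ?_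
    have h3 := Ideal.mem_map_of_mem (includeLeft : H →ₐ[k] H ⊗[k] K)
      (Ideal.mem_map_of_mem (iterateFrobenius H p M) hy)
    rw [Ideal.mem_comap, Ideal.mem_comap, iterateFrobenius_def, ← map_pow]
    exact h3
  have h3 : (augFrobPow k p H M).map (includeLeft : H →ₐ[k] H ⊗[k] K) ≤
      RingHom.ker (map f (AlgHom.id k K)) := by
    refine Ideal.map_le_iff_le_comap.2 fun y hy => ?_
    rw [Ideal.mem_comap, RingHom.mem_ker]
    simp [hfJ y hy]
  have h4 : map f (AlgHom.id k K) ((rcoact π x - 1 ⊗ₜ π x) ^ p ^ M) = 0 := h3 (h2 h1)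
  rw [sub_pow_char_pow, map_sub, sub_eq_zero, map_pow, map_pow] at h4
  refine h4.trans ?_
  rw [map_tmul, map_one, tmul_pow, one_pow]
  rfl

/-- The comparison induces a surjection from `H / J_M` onto `B` tensored with the corresponding
quotient of `K`; the rank bound makes it injective. -/
theorem mem_augFrobPow_of_comparison_eq_zero [CharP K p] {M : ℕ}
    (hfJ : ∀ j ∈ augFrobPow k p H M, f j = 0)
    (hs : Function.Surjective (comparison π f)) [Module.Finite k (H ⧸ augFrobPow k p H M)]
    [Module.Finite k B] [Module.Finite k (K ⧸ augFrobPow k p K M)]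
    (hrank : Module.finrank k (H ⧸ augFrobPow k p H M) ≤
      Module.finrank k B * Module.finrank k (K ⧸ augFrobPow k p K M))
    {l : H} (hl : comparison π f l = 0) : l ∈ augFrobPow k p H M := by
  let Ψ : H →ₐ[k] B ⊗[k] (K ⧸ augFrobPow k p K M) :=
    (map (AlgHom.id k B) (Ideal.Quotient.mkₐ k (augFrobPow k p K M))).comp (comparison π f)
  have hΨs : Function.Surjective Ψ :=
    (TensorProduct.map_surjective Function.surjective_id
      (Ideal.Quotient.mkₐ_surjective k (augFrobPow k p K M))).comp hs
  have hΨJ : augFrobPow k p H M ≤ RingHom.ker Ψ := by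
    refine Ideal.map_le_iff_le_comap.2 fun y hy => ?_
    rw [Ideal.mem_comap, RingHom.mem_ker, iterateFrobenius_def]
    simp only [Ψ, AlgHom.comp_apply]
    rw [map_pow, comparison_pow_eq hfJ, map_tmul]
    have h1 : π y ∈ augIdeal k K := (CoalgHomClass.counit_comp_apply π y).trans hy
    have h2 : Ideal.Quotient.mkₐ k (augFrobPow k p K M) (π y ^ p ^ M) = 0 :=
      Ideal.Quotient.eq_zero_iff_mem.2 (Ideal.mem_map_of_mem (iterateFrobenius K p M) h1)
    rw [h2, TensorProduct.tmul_zero]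
  let Ψ' : (H ⧸ augFrobPow k p H M) →ₐ[k] B ⊗[k] (K ⧸ augFrobPow k p K M) :=
    Ideal.Quotient.liftₐ _ Ψ hΨJ
  have hΨ's : Function.Surjective Ψ'.toLinearMap := by
    intro z
    obtain ⟨y, rfl⟩ := hΨs z
    exact ⟨Ideal.Quotient.mk _ y, rfl⟩
  have hrank' : Module.finrank k (H ⧸ augFrobPow k p H M) =
      Module.finrank k (B ⊗[k] (K ⧸ augFrobPow k p K M)) := by
    refine le_antisymm ?_ (LinearMap.finrank_le_finrank_of_surjective hΨ's)
    rwa [Module.finrank_tensorProduct]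
  have hinj := (LinearMap.injective_iff_surjective_of_finrank_eq_finrank hrank').2 hΨ's
  refine Ideal.Quotient.eq_zero_iff_mem.1 (hinj ?_)
  rw [map_zero]
  change Ψ l = 0
  simp [Ψ, hl]

end Kernel

/-! ### Bijectivity of the comparison map. -/

section Main

variable {k : Type u} [Field k] {p : ℕ} [Fact p.Prime]

/-- Since `J_M ⊆ m ^ M`, the ideal lies in every power of `m`. Krull's intersection theorem gives `L
= m L`, and Nakayama's lemma provides `c`. -/
theorem exists_counit_eq_one_mul_eq_zero {H : Type v} [CommRing H] [Bialgebra k H] [CharP H p]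
    [IsNoetherianRing H] (L : Ideal H) (M : ℕ) (hL : ∀ M' ≥ M, L ≤ augFrobPow k p H M') :
    ∃ c, Coalgebra.counit (R := k) c = 1 ∧ ∀ l ∈ L, c * l = 0 := by
  have h1 : L ≤ augIdeal k H • L := by
    intro l hl
    have h2 : l ∈ (⨅ i : ℕ, augIdeal k H ^ i • ⊤ : Submodule H H) := by
      rw [Submodule.mem_iInf]
      intro i
      rw [smul_eq_mul, Ideal.mul_top]
      exact Ideal.pow_le_pow_right (le_max_left i M)
        (augFrobPow_le_augIdeal_pow _ (hL (max i M) (le_max_right i M) hl))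
    obtain ⟨r, hr⟩ := (Ideal.mem_iInf_smul_pow_eq_bot_iff (augIdeal k H) l).1 h2
    rw [← hr]
    exact Submodule.smul_mem_smul r.2 hl
  obtain ⟨c, hc, hc'⟩ := Submodule.exists_sub_one_mem_and_smul_eq_zero_of_fg_of_le_smul
    (augIdeal k H) L (IsNoetherian.noetherian L) h1
  refine ⟨c, ?_, hc'⟩
  rw [mem_augIdeal, map_sub, sub_eq_zero, Bialgebra.counit_one] at hc
  exact hc

theorem finite_and_finrank_quotient_augFrobPow_le {H : Type v} [CommRing H] [Bialgebra k H]
    [CharP H p] [Algebra.FiniteType k H] {ι : Type*} [Fintype ι] [DecidableEq ι] (x : ι → H)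
    (hx : ∀ i, x i ∈ augIdeal k H)
    (hgen : ∀ y ∈ augIdeal k H, ∃ c : ι → k, y - ∑ i, c i • x i ∈ augIdeal k H ^ 2) (M : ℕ)
    (e : ι → ℕ) (hxJ : ∀ i, x i ^ p ^ e i ∈ augFrobPow k p H M) :
    Module.Finite k (H ⧸ augFrobPow k p H M) ∧
      Module.finrank k (H ⧸ augFrobPow k p H M) ≤ (box p e).card := by
  have hnoeth : IsNoetherianRing H := Algebra.FiniteType.isNoetherianRing k H
  refine finite_and_finrank_le_card (box p e)
    (fun a => Ideal.Quotient.mkₐ k (augFrobPow k p H M) (∏ i, x i ^ a i)) fun y => ?_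
  obtain ⟨h, rfl⟩ := Ideal.Quotient.mkₐ_surjective k _ y
  obtain ⟨c, hc⟩ := exists_sub_sum_box_mem (p := p) x hx hgen _
    (augIdeal_le_radical_augFrobPow M) e hxJ h
  have h1 : Ideal.Quotient.mkₐ k (augFrobPow k p H M) _ = 0 := Ideal.Quotient.eq_zero_iff_mem.2 hc
  rw [map_sub, sub_eq_zero, map_sum] at h1
  exact ⟨c, by simpa only [map_smul] using h1⟩

variable [CharP k p] [PerfectField k]

theorem card_box_le_finrank_quotient_augFrobPow {H : Type v} [CommRing H] [Bialgebra k H]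
    [CharP H p] [Algebra.FiniteType k H] {ι : Type*} [Fintype ι] [DecidableEq ι] (x : ι → H)
    (hx : ∀ i, x i ∈ augIdeal k H)
    (hgen : ∀ y ∈ augIdeal k H, ∃ c : ι → k, y - ∑ i, c i • x i ∈ augIdeal k H ^ 2) (M : ℕ)
    (e : ι → ℕ) (he : ∀ i, e i ≤ M) (hxJ : ∀ i, x i ^ p ^ e i ∈ augFrobPow k p H M)
    (hA : IsAdapted k p x e) :
    (box p e).card ≤ Module.finrank k (H ⧸ augFrobPow k p H M) := by
  have := (finite_and_finrank_quotient_augFrobPow_le x hx hgen M e hxJ).1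
  refine card_le_finrank_of_forall_coeff_eq_zero (box p e)
    (fun a => Ideal.Quotient.mkₐ k (augFrobPow k p H M) (∏ i, x i ^ a i)) fun c hc => ?_
  refine coeff_eq_zero_of_sum_box_mem_augFrobPow x hx hgen M e he hxJ hA c ?_
  refine Ideal.Quotient.eq_zero_iff_mem.1 (?_ : Ideal.Quotient.mkₐ k (augFrobPow k p H M) _ = 0)
  rw [map_sum]
  simpa only [map_smul] using hc

/-- For a suitable algebra map `f` onto a truncated polynomial algebra, the map
`h ↦ f (h₍₁₎) ⊗ π (h₍₂₎)` is bijective. -/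
theorem exists_bijective_comparison (p : ℕ) [Fact p.Prime] [CharP k p] (H : Type v) [CommRing H]
    [HopfAlgebra k H] [Algebra.FiniteType k H] [(nilradical H).IsHopfIdeal k] :
    ∃ (n : ℕ) (e : Fin n → ℕ) (f : H →ₐ[k] TruncPoly k p e), (∀ i, 0 < e i) ∧
      Function.Bijective (comparison (Bialgebra.Quotient.mkBialgHom (R := k) (nilradical H)) f) := by
  classical
  have hp := (Fact.out : p.Prime)
  have hnoeth : IsNoetherianRing H := Algebra.FiniteType.isNoetherianRing k H
  have : CharP H p := charP_of_bialgebra k p H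
  let K := H ⧸ nilradical H
  have : CharP K p := charP_of_bialgebra k p K
  have hKred : IsReduced K :=
    (Ideal.isRadical_iff_quotient_reduced _).1 (Ideal.radical_isRadical _)
  let π : H →ₐc[k] K := Bialgebra.Quotient.mkBialgHom (R := k) (nilradical H)
  have hπ : Function.Surjective π := Ideal.Quotient.mk_surjective
  have hπε : ∀ y, Coalgebra.counit (R := k) (π y) = Coalgebra.counit y := fun y => rfl
  have hkerπ : RingHom.ker (π : H →ₐ[k] K) = nilradical H := Ideal.mk_ker
  have hnil : IsNilpotent (RingHom.ker (π : H →ₐ[k] K)) := by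
    rw [hkerπ]
    exact IsNoetherianRing.isNilpotent_nilradical H
  obtain ⟨M, r, n, u, t, e, hM, hx, ht, hgen, hA, hu⟩ := exists_parameters (k := k) (p := p) (H := H)
  obtain ⟨f, hfs, hfJ, hfε⟩ := exists_truncation_hom u t e hx (fun j => (ht j).2) hgen (hA M le_rfl)
  have hs : Function.Surjective (comparison π f) :=
    comparison_surjective hπ hnil hfs (by rwa [hkerπ])
  have hmap : (augIdeal k H).map (π : H →ₐ[k] K) = augIdeal k K := by
    refine le_antisymm (Ideal.map_le_iff_le_comap.2 fun y hy => hy) fun y hy => ?_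
    obtain ⟨y, rfl⟩ := hπ y
    exact Ideal.mem_map_of_mem (π : H →ₐ[k] K) (show y ∈ augIdeal k H from hy)
  have hKx : ∀ i, π (u i) ∈ augIdeal k K := fun i => hx (Sum.inl i)
  have hKgen : ∀ y ∈ augIdeal k K, ∃ c : Fin r → k,
      y - ∑ i, c i • π (u i) ∈ augIdeal k K ^ 2 := by
    intro y hy
    obtain ⟨y, rfl⟩ := hπ y
    obtain ⟨c, hc⟩ := hgen y hy
    refine ⟨fun i => c (Sum.inl i), ?_⟩
    have h1 := Ideal.mem_map_of_mem (π : H →ₐ[k] K) hc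
    rw [Ideal.map_pow, hmap, Fintype.sum_sum_type] at h1
    have h2 : ∀ j, π (t j) = 0 := fun j =>
      Ideal.Quotient.eq_zero_iff_mem.2 (mem_nilradical.2 ⟨_, (ht j).2.2⟩)
    simpa [h2] using h1
  -- Frobenius is injective on the reduced ring `K`, so adaptedness is just independence of the `u
  -- i` modulo `m²` and the nilradical.
  have hKA : ∀ M', IsAdapted k p (fun i => π (u i)) (fun _ => M') := by
    intro M' s c _ hc
    have h1 : RingHom.ker (iterateFrobenius K p s) = ⊥ := by
      rw [eq_bot_iff]
      intro y hy
      exact eq_zero_of_pow_eq_zero (n := p ^ s) hy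
    rw [h1, sup_bot_eq, ← hmap, ← Ideal.map_pow] at hc
    refine hu c ?_
    obtain ⟨y, hy, hyc⟩ := (Ideal.mem_map_iff_of_surjective (π : H →ₐ[k] K) hπ).1 hc
    have h2 : (∑ i, c i • u i) - y ∈ nilradical H := by
      rw [← hkerπ, RingHom.mem_ker, map_sub, hyc, map_sum]
      simp
    have h3 := Ideal.add_mem _ (Ideal.mem_sup_left (T := nilradical H) hy)
      (Ideal.mem_sup_right (S := augIdeal k H ^ 2) h2)
    rwa [add_sub_cancel] at h3
  have hBfin : Module.Finite k (TruncPoly k p e) ∧ (box p e).card ≤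
      Module.finrank k (TruncPoly k p e) := by
    have h1 : Module.Finite k (TruncPoly k p e) :=
      (finite_and_finrank_le_card (box p e) (fun a => ∏ i, TruncPoly.gen k p e i ^ a i) fun y => by
        obtain ⟨P, rfl⟩ := Ideal.Quotient.mkₐ_surjective k _ y
        rw [← TruncPoly.aeval_gen]
        exact ⟨_, aeval_eq_sum_box (TruncPoly.gen_pow e) P⟩).1
    exact ⟨h1, card_le_finrank_of_forall_coeff_eq_zero _ _ (TruncPoly.coeff_eq_zero e)⟩
  -- The monomials in `u, t` bound the dimension for `H` above by the product of two box sizes;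
  -- independence bounds those of `B` and of the quotient of `K` below by one factor each.
  have hL : ∀ M' ≥ M, RingHom.ker (comparison π f) ≤ augFrobPow k p H M' := by
    intro M' hM' l hl
    obtain ⟨h1, h2⟩ := finite_and_finrank_quotient_augFrobPow_le (p := p) (Sum.elim u t) hx hgen M'
      (Sum.elim (fun _ => M') e) (by
        rintro (i | i)
        · exact Ideal.mem_map_of_mem (iterateFrobenius H p M') (hx (Sum.inl i))
        · have : t i ^ p ^ e i = 0 := (ht i).2.2
          simp [this])
    have hKJ : ∀ i, π (u i) ^ p ^ M' ∈ augFrobPow k p K M' := fun i =>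
      Ideal.mem_map_of_mem (iterateFrobenius K p M') (hKx i)
    have h3 := (finite_and_finrank_quotient_augFrobPow_le (p := p) _ hKx hKgen M'
      (fun _ => M') hKJ).1
    have h4 := card_box_le_finrank_quotient_augFrobPow (p := p) _ hKx hKgen M'
      (fun _ => M') (fun _ => le_rfl) hKJ (hKA M')
    have := hBfin.1
    refine mem_augFrobPow_of_comparison_eq_zero
      (fun j hj => hfJ j (augFrobPow_antitone hM' hj)) hs (h2.trans ?_) hl
    rw [card_box_sum, mul_comm]
    exact Nat.mul_le_mul hBfin.2 h4
  obtain ⟨c, hc, hcL⟩ := exists_counit_eq_one_mul_eq_zero _ M hL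
  exact ⟨n, e, f, fun i => (ht i).1, comparison_injective hπ hnil hs c hc hcL, hs⟩

end Main

end HopfRed

theorem proposition3p4 {k : Type*} [Field k] (p : ℕ) [Fact p.Prime] [CharP k p] [PerfectField k]
    (H : Type*) [CommRing H] [HopfAlgebra k H] [Algebra.FiniteType k H]
    (hH : nilradical H ≠ ⊥) :
    haveI : (nilradical H).IsHopfIdeal k := HopfRed.nilradical_isHopfIdeal p H
    ∃ (n : ℕ) (e : Fin n → ℕ), 0 < n ∧ (∀ i, 0 < e i) ∧
      Nonempty (HopfRed.ComoduleAlgebra.Iso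
        (HopfRed.ComoduleAlgebra.ofBialgHom
          (Bialgebra.Quotient.mkBialgHom (R := k) (nilradical H)))
        (HopfRed.ComoduleAlgebra.tensor (k := k) (K := H ⧸ nilradical H)
          (HopfRed.TruncPoly k p e))) := by
  have hI : (nilradical H).IsHopfIdeal k := HopfRed.nilradical_isHopfIdeal p H
  obtain ⟨n, e, f, he, hf⟩ := HopfRed.exists_bijective_comparison (k := k) p H
  refine ⟨n, e, Nat.pos_of_ne_zero ?_, he, ⟨⟨AlgEquiv.ofBijective _ hf, fun a => ?_⟩⟩⟩
  -- With no variables, the target is a tensor product of reduced algebras, so `H` would be reduced.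
  · rintro rfl
    have hB := HopfRed.TruncPoly.isReduced_of_zero (k := k) (p := p) e
    have hK : IsReduced (H ⧸ nilradical H) :=
      (Ideal.isRadical_iff_quotient_reduced _).1 (Ideal.radical_isRadical _)
    have hR : IsReduced (HopfRed.TruncPoly k p e ⊗[k] (H ⧸ nilradical H)) :=
      HopfRed.isReduced_tensorProduct p
    have hred : IsReduced H := isReduced_of_injective _ hf.1
    exact hH (nilradical_eq_zero H)
  · exact HopfRed.comparison_colinear _ f a
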